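/- Let $d,m\ge 1$ and $n\ge 0$ be integers, $t_1,\dots,t_m\in[0,1)^d$ pairwise different, $c_1,\dots,c_m\in\mathbb C\setminus\{0\}$, and $f(k)=\sum_{j=1}^m c_je^{-2\pi\iota\langle t_j,k\rangle}$ for $k\in\mathbb Z^d$. Put $z_j(\ell)=e^{-2\pi\iota t_j(\ell)}$, $I_n=\{0,\dots,n\}^d$, $N=(n+1)^d$, $T=[f(k-h)]_{k,h\in I_n}$ and $T_\ell=[f(k-h+e_\ell)]_{k,h\in I_n}$ for $\ell=1,\dots,d$. Assume $\operatorname{rank}T=m$, and let $\mu\in\mathbb C^d$ with $\|\mu\|_2=1$. **The algorithm.** From samples $f$, the matrix pencil method for $m$ terms takes a singular value decomposition of $T$ with $\sigma_1\ge\dots\ge\sigma_N\ge0$. Let $U,V\in\mathbb C^{N\times m}$ consist of the left and right singular vectors for the $m$ largest singular values, and let $\Sigma=\operatorname{diag}(\sigma_1,\dots,\sigma_m)$. The method forms $S_\ell=U^*T_\ell V\Sigma^{-1}$. It takes an invertible $W$ with columns of Euclidean norm one such that $W^{-1}\big(\sum_\ell\mu_\ell S_\ell\big)W=\operatorname{diag}(\lambda_1,\dots,\lambda_m)$.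 The recovered nodes are the diagonal entries $(W^{-1}S_\ell W)(j,j)$. The recovered parameters are the representatives in $[0,1)$ of $\operatorname{Re}\big(\log (W^{-1}S_\ell W)(j,j)/(-2\pi\iota)\big)$, where $\log$ is the principal logarithm. All steps are in exact arithmetic. Fix a run of the algorithm on the exact samples $f$, with the notation above, and assume that $\lambda_1,\dots,\lambda_m$ are distinct. Then $W$ diagonalizes all $S_\ell$ simultaneously: after renumbering the $t_j$ (and correspondingly the $z_j$ and $c_j$), $W^{-1}S_\ell W=\Lambda_\ell:=\operatorname{diag}(z_1(\ell),\dots,z_m(\ell))$ for all $\ell$. **Claim.** There is an absolute constant $g>0$, and for every exact run as above there are $K$ and $\varepsilon_0>0$ (depending only on the exact problem and on this exact run), such that the following holds. Let $0\le\varepsilon\le\varepsilon_0$ and let $\tilde f$ satisfy $|\tilde f(k)-f(k)|\le\varepsilon|f(k)|$ at all points $k$ whose samples enter $T,T_1,\dots,T_d$. Consider any run of the algorithm on $\tilde f$ with the same $m,n,\mu$; its quantities carry a tilde. Let $$\delta_{\min}=\min_{1\le i\le m}\min\Big\{\min_{1\le j\le N,\ j\ne i}|\sigma_i-\tilde\sigma_j|,\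 \sigma_i\Big\},$$ and assume $\delta_{\min}>0$. Then $\tilde\sigma_m>0$. Moreover, the columns of $\tilde W$ can be ordered so that $|\tilde\lambda_i-\lambda_i|<|\tilde\lambda_i-\lambda_j|$ for all $j\ne i$, and so that, with $$\gamma=\min_{i\ne j}|\lambda_j-\tilde\lambda_i|,\qquad \Delta\Lambda_\ell=\tilde W^{-1}\tilde S_\ell\tilde W-\Lambda_\ell,\qquad \tilde z_j(\ell)=(\tilde W^{-1}\tilde S_\ell\tilde W)(j,j),\qquad \Delta z_j=\tilde z_j-z_j,$$ $$B_\ell=\left(\frac{2\sqrt{md}\,\|\Lambda_\ell\|_2}{\gamma\,\tilde\sigma_m\,\sigma_{\min}(W)}+\frac1{\tilde\sigma_m}\right)\left(1+\frac{(1+4\sqrt2+(2+g)\sqrt{2m})\,\|T\|_F}{\delta_{\min}}\right)\max_{1\le p\le d}\|T_p\|_F\ \kappa_2(W)$$ (for $m=1$ the term containing $\gamma$ is omitted), the following bounds hold for all $\ell=1,\dots,d$ and $j=1,\dots,m$: 1. $\|\Delta\Lambda_\ell\|_F\le\varepsilon B_\ell+K\varepsilon^2$; 2. $|\Delta z_j(\ell)|\le\varepsilon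 B_\ell+K\varepsilon^2$; 3. if $\eta:=\min_{j,i}|\operatorname{Re}z_j(i)\,\operatorname{Im}z_j(i)|>0$, then the recovered parameters satisfy $$|\tilde t_j(\ell)-t_j(\ell)|\le\frac{|\Delta z_j(\ell)|}{\pi\eta}+K\varepsilon^2.$$ Here $\|\cdot\|_F$ is the Frobenius norm, $\|\cdot\|_2$ the spectral norm, $\kappa_2(W)=\|W\|_2\|W^{-1}\|_2$, and $\sigma_{\min}(W)$ is the smallest singular value of $W$. -/

import Mathlib

open scoped Matrix

namespace Prony

/-- The grid `I_n = {0, …, n}^d`, of cardinality `N = (n+1)^d`. -/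
abbrev Grid (d n : ℕ) : Type := Fin d → Fin (n + 1)

/-- The node `z = (e^{-2πi t(1)}, …, e^{-2πi t(d)})` of a parameter vector `t`. -/
noncomputable def node {d : ℕ} (t : Fin d → ℝ) (ℓ : Fin d) : ℂ :=
  Complex.exp (-2 * Real.pi * Complex.I * (t ℓ : ℂ))

/-- The sparse exponential sum `f(k) = ∑ j, c j * e^{-2πi ⟨t j, k⟩}` on `ℤ^d`. -/
noncomputable def expSum {d m : ℕ} (t : Fin m → Fin d → ℝ) (c : Fin m → ℂ)
    (k : Fin d → ℤ) : ℂ :=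
  ∑ j, c j * Complex.exp (-2 * Real.pi * Complex.I * ((∑ ℓ, t j ℓ * (k ℓ : ℝ) : ℝ) : ℂ))

/-- The matrix `[f(k - h + s)]` with `k, h` in the grid. -/
def sampleMatrix {d : ℕ} (n : ℕ) (f : (Fin d → ℤ) → ℂ) (s : Fin d → ℤ) :
    Matrix (Grid d n) (Grid d n) ℂ :=
  Matrix.of fun k h => f fun i => ((k i : ℕ) : ℤ) - ((h i : ℕ) : ℤ) + s i

/-- `T = [f(k - h)]`. -/
def matT {d : ℕ} (n : ℕ) (f : (Fin d → ℤ) → ℂ) : Matrix (Grid d n) (Grid d n) ℂ :=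
  sampleMatrix n f 0

/-- `T_ℓ = [f(k - h + e_ℓ)]`. -/
def matTl {d : ℕ} (n : ℕ) (f : (Fin d → ℤ) → ℂ) (ℓ : Fin d) :
    Matrix (Grid d n) (Grid d n) ℂ :=
  sampleMatrix n f (Pi.single ℓ 1)

/-- The points at which samples enter `T, T_1, …, T_d`. -/
def samplePoints (d n : ℕ) : Set (Fin d → ℤ) :=
  {x | ∃ k h : Grid d n,
      (x = fun i => ((k i : ℕ) : ℤ) - ((h i : ℕ) : ℤ)) ∨
      ∃ ℓ : Fin d, x = fun i => ((k i : ℕ) : ℤ) - ((h i : ℕ) : ℤ) + (Pi.single ℓ 1 : Fin d → ℤ) i}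

/-- Frobenius norm. -/
noncomputable def frobNorm {ι κ : Type*} [Fintype ι] [Fintype κ] (A : Matrix ι κ ℂ) : ℝ :=
  Real.sqrt (∑ i, ∑ j, ‖A i j‖ ^ 2)

/-- Spectral norm. -/
noncomputable def specNorm {m : ℕ} (A : Matrix (Fin m) (Fin m) ℂ) : ℝ :=
  ‖Matrix.toEuclideanCLM (𝕜 := ℂ) A‖

/-- Spectral condition number `κ₂`. -/
noncomputable def cond2 {m : ℕ} (A : Matrix (Fin m) (Fin m) ℂ) : ℝ :=
  specNorm A * specNorm A⁻¹

/-- The smallest singular value of an `m × m` matrix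
(Mathlib lists the singular values in nonincreasing order, starting from index `0`). -/
noncomputable def sigmaMin {m : ℕ} (A : Matrix (Fin m) (Fin m) ℂ) : ℝ :=
  (Matrix.toEuclideanLin A).singularValues (m - 1)

/-- `A = U diag(σ) Vᴴ` is a full singular value decomposition of the square matrix `A`,
with the singular values in nonincreasing order. -/
structure IsSVD {ι : Type*} [Fintype ι] [DecidableEq ι] (A : Matrix ι ι ℂ)
    (U : Matrix ι (Fin (Fintype.card ι)) ℂ) (σ : Fin (Fintype.card ι) → ℝ)
    (V : Matrix ι (Fin (Fintype.card ι)) ℂ) : Prop where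
  orthU : Uᴴ * U = 1
  orthV : Vᴴ * V = 1
  anti : Antitone σ
  nonneg : ∀ i, 0 ≤ σ i
  eq : A = U * Matrix.diagonal (fun i => (σ i : ℂ)) * Vᴴ

/-- The first `m` columns. -/
def firstCols {ι : Type*} {N m : ℕ} (hm : m ≤ N) (U : Matrix ι (Fin N) ℂ) :
    Matrix ι (Fin m) ℂ :=
  U.submatrix id (Fin.castLE hm)

/-- `S_ℓ = U_mᴴ T_ℓ V_m Σ_m⁻¹`, where `U_m, V_m` are the first `m` columns of `U, V` and `Σ_m`
is the diagonal matrix of the `m` largest singular values. -/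
noncomputable def matS {ι : Type*} [Fintype ι] {N m : ℕ} (hm : m ≤ N)
    (U : Matrix ι (Fin N) ℂ) (σ : Fin N → ℝ) (V : Matrix ι (Fin N) ℂ) (Tl : Matrix ι ι ℂ) :
    Matrix (Fin m) (Fin m) ℂ :=
  (firstCols hm U)ᴴ * Tl * firstCols hm V *
    (Matrix.diagonal fun i : Fin m => (σ (Fin.castLE hm i) : ℂ))⁻¹

/-- A run, in exact arithmetic, of the multivariate matrix pencil algorithm on the samples `f`, for
`m` terms, the grid size `n` and the weights `μ`: a singular value decomposition of `T`
and an invertible matrix `W` with columns of Euclidean norm one that diagonalizes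
`C_μ = ∑ ℓ, μ ℓ • S_ℓ`, with eigenvalues `lam`. -/
structure Run {d : ℕ} (n m : ℕ) (μ : Fin d → ℂ) (f : (Fin d → ℤ) → ℂ) where
  hm : m ≤ Fintype.card (Grid d n)
  U : Matrix (Grid d n) (Fin (Fintype.card (Grid d n))) ℂ
  σ : Fin (Fintype.card (Grid d n)) → ℝ
  V : Matrix (Grid d n) (Fin (Fintype.card (Grid d n))) ℂ
  svd : IsSVD (matT n f) U σ V
  W : Matrix (Fin m) (Fin m) ℂ
  lam : Fin m → ℂ
  W_unit : IsUnit W.det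
  W_norm : ∀ j, ∑ i, ‖W i j‖ ^ 2 = 1
  W_diag : W⁻¹ * (∑ ℓ, μ ℓ • matS hm U σ V (matTl n f ℓ)) * W = Matrix.diagonal lam

namespace Run

variable {d n m : ℕ} {μ : Fin d → ℂ} {f : (Fin d → ℤ) → ℂ}

/-- The matrix `W⁻¹ S_ℓ W` computed by the run. -/
noncomputable def diagonalized (R : Run n m μ f) (ℓ : Fin d) : Matrix (Fin m) (Fin m) ℂ :=
  R.W⁻¹ * matS R.hm R.U R.σ R.V (matTl n f ℓ) * R.W

/-- The recovered nodes: `z_j(ℓ)` is the `j`-th diagonal entry of `W⁻¹ S_ℓ W`. -/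
noncomputable def recNode (R : Run n m μ f) (j : Fin m) (ℓ : Fin d) : ℂ :=
  R.diagonalized ℓ j j

/-- The recovered parameters: the representative in `[0, 1)` of
`Re (log z_j(ℓ) / (-2πi))`, with the principal value of the logarithm. -/
noncomputable def recParam (R : Run n m μ f) (j : Fin m) (ℓ : Fin d) : ℝ :=
  Int.fract (Complex.log (R.recNode j ℓ) / (-2 * Real.pi * Complex.I)).re

/-- The `i`-th singular value, `i = 1, …, m`. -/
def sv (R : Run n m μ f) (i : Fin m) : ℝ := R.σ (Fin.castLE R.hm i)

/-- The smallest of the `m` largest singular values, that is `σ_m`. -/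
noncomputable def svLast (R : Run n m μ f) : ℝ := ⨅ i : Fin m, R.sv i

end Run

section Gaps

variable {d n m : ℕ} {μ : Fin d → ℂ} {f f' : (Fin d → ℤ) → ℂ}

/-- `δ_i = min { min_{1 ≤ j ≤ N, j ≠ i} |σ_i - σ̃_j|, σ_i }`. -/
noncomputable def deltaGap (R : Run n m μ f) (R' : Run n m μ f') (i : Fin m) : ℝ :=
  sInf ({R.sv i} ∪ {x | ∃ j, j ≠ Fin.castLE R.hm i ∧ x = |R.sv i - R'.σ j|})

/-- `δ_min = min_{1 ≤ i ≤ m} δ_i`. -/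
noncomputable def deltaMin (R : Run n m μ f) (R' : Run n m μ f') : ℝ :=
  ⨅ i : Fin m, deltaGap R R' i

/-- `γ = min_{i ≠ j} |λ_j - λ̃_i|`, where `λ̃_{τ i}` is the eigenvalue matched with `λ_i`.
For `m = 1` the minimum is over the empty set; the value is then `0`, so that `x / γ = 0`,
in accordance with the convention `min ∅ = ∞`. -/
noncomputable def gammaGap (R : Run n m μ f) (R' : Run n m μ f') (τ : Equiv.Perm (Fin m)) : ℝ :=
  sInf {x | ∃ i j : Fin m, j ≠ i ∧ x = ‖R.lam j - R'.lam (τ i)‖}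

/-- The coefficient of `ε` in the bound for the node errors. -/
noncomputable def errorCoeff (g : ℝ) (R : Run n m μ f) (R' : Run n m μ f')
    (τ : Equiv.Perm (Fin m)) (L : Matrix (Fin m) (Fin m) ℂ) : ℝ :=
  (2 * Real.sqrt ((m : ℝ) * d) * specNorm L / (gammaGap R R' τ * R'.svLast * sigmaMin R.W)
      + 1 / R'.svLast)
    * (1 + (1 + 4 * Real.sqrt 2 + (2 + g) * Real.sqrt (2 * m)) * frobNorm (matT n f)
        / deltaMin R R')
    * (⨆ ℓ : Fin d, frobNorm (matTl n f ℓ)) * cond2 R.W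

end Gaps

/-- `η = min_{j, i} |Re z_j(i) * Im z_j(i)|`. -/
noncomputable def eta {d m : ℕ} (t : Fin m → Fin d → ℝ) : ℝ :=
  ⨅ p : Fin m × Fin d, |(node (t p.1) p.2).re * (node (t p.1) p.2).im|

end Prony

/-!
The matrix `T = A C Aᴴ` factors through the Vandermonde matrix `A`, and `T_ℓ = A D_ℓ C Aᴴ` with
`D_ℓ` the diagonal matrix of the `ℓ`-th node coordinates. Since `T` has rank `m`, the left
singular vectors satisfy `A = U B⁻¹`, so that `S_ℓ = B⁻¹ D_ℓ B` and `T_ℓ = U S_ℓ Uᴴ T`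
(`exists_conj_of_factorization`). A matrix `W` that diagonalizes one combination of the `S_ℓ` with
distinct eigenvalues equals `B⁻¹` up to a monomial factor, hence diagonalizes all of them
(`exists_perm_of_conj_diagonal`).

For perturbed samples, put `X = U'ᴴ U`. From `T_ℓ = U S_ℓ Uᴴ T` and `T' V' = U' Σ'` one gets the
exact identity `S'_ℓ = X S_ℓ Xᴴ + (U'ᴴ (T'_ℓ - T_ℓ) - X S_ℓ Uᴴ (T' - T)) V' Σ'⁻¹`, and `1 - X Xᴴ`
is of second order. Thus `Q = X⁻¹` intertwines all the `S'_ℓ` with the `S_ℓ`, with errors of first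
order (`exists_intertwiner`). Only the subspaces spanned by the singular vectors matter here, so
the bound involves the smallest singular value `σ_m` in place of the gaps among the singular
values; this suffices because `δ_min ≤ σ_m`. That `σ'_m` stays positive is Weyl's inequality
(`IsSVD.apply_le`).

The matrix `Y = W⁻¹ Q W'` intertwines `diag λ'` with `diag λ` up to a small matrix `F`. Continuity
of the characteristic polynomial matches the eigenvalues (`exists_perm_eigenvalues_close`), after
which the off-diagonal entries of `Y` are `F i j / (λ'_j - λ_i)`, while the normalization of the
columns of `W` and `W'` bounds its diagonal from below. Since
`Y (Λ'_ℓ - Λ_ℓ) = Λ_ℓ Y - Y Λ_ℓ + F_ℓ`, where only the off-diagonal part of `Y` contributes to the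
commutator, the bound on `Λ'_ℓ - Λ_ℓ` follows (`frobNorm_sub_diagonal_le`). With `g = 7` the
coefficient in the theorem exceeds the first-order constant by a fixed factor, which absorbs the
terms of higher order, so `K = 0` is possible (`bound_le_coeff`).

For the parameters, `log z' = -2πi t + log (z' / z) + 2πi k` for some integer `k`; when `η > 0` no
`t_j(ℓ)` is `0`, and the representative in `[0, 1)` does not jump (`abs_fract_log_sub_le`).
-/

namespace Prony

open scoped Matrix.Norms.L2Operator

/-! ### Spectral and Frobenius norms -/

section Norms

variable {ι κ l : Type*} [Fintype ι] [Fintype κ] [Fintype l]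

theorem frobNorm_nonneg (A : Matrix ι κ ℂ) : 0 ≤ frobNorm A := Real.sqrt_nonneg _

theorem frobNorm_sq (A : Matrix ι κ ℂ) : frobNorm A ^ 2 = ∑ i, ∑ j, ‖A i j‖ ^ 2 :=
  Real.sq_sqrt (by positivity)

/-- The Frobenius norm is that of Mathlib, which is not the norm instance in force here: `‖A‖`
denotes the spectral norm throughout. -/
theorem frobNorm_eq_norm (A : Matrix ι κ ℂ) :
    frobNorm A = @norm _ Matrix.frobeniusNormedAddCommGroup.toNorm A := by
  rw [Matrix.frobenius_norm_def, frobNorm, Real.sqrt_eq_rpow]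
  simp

theorem frobNorm_add_le (A B : Matrix ι κ ℂ) : frobNorm (A + B) ≤ frobNorm A + frobNorm B := by
  simp only [frobNorm_eq_norm]
  exact @norm_add_le _
    Matrix.frobeniusNormedAddCommGroup.toSeminormedAddCommGroup.toSeminormedAddGroup A B

theorem frobNorm_sub_le (A B : Matrix ι κ ℂ) : frobNorm (A - B) ≤ frobNorm A + frobNorm B := by
  simp only [frobNorm_eq_norm]
  exact @norm_sub_le _
    Matrix.frobeniusNormedAddCommGroup.toSeminormedAddCommGroup.toSeminormedAddGroup A B

theorem frobNorm_smul (a : ℂ) (A : Matrix ι κ ℂ) : frobNorm (a • A) = ‖a‖ * frobNorm A := by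
  rw [frobNorm, frobNorm, ← Real.sqrt_sq (norm_nonneg a), ← Real.sqrt_mul (sq_nonneg _)]
  simp [Finset.mul_sum, mul_pow]

theorem frobNorm_sum_le {α : Type*} (s : Finset α) (A : α → Matrix ι κ ℂ) :
    frobNorm (∑ a ∈ s, A a) ≤ ∑ a ∈ s, frobNorm (A a) := by
  classical
  induction s using Finset.induction_on with
  | empty => simp [frobNorm]
  | insert a s ha ih =>
    rw [Finset.sum_insert ha, Finset.sum_insert ha]
    exact (frobNorm_add_le _ _).trans (by gcongr)

theorem frobNorm_conjTranspose (A : Matrix ι κ ℂ) : frobNorm Aᴴ = frobNorm A := by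
  simp only [frobNorm, Matrix.conjTranspose_apply, norm_star]
  rw [Finset.sum_comm]

theorem norm_apply_le_frobNorm (A : Matrix ι κ ℂ) (i : ι) (j : κ) : ‖A i j‖ ≤ frobNorm A := by
  refine Real.le_sqrt_of_sq_le ?_
  refine le_trans ?_ (Finset.single_le_sum (f := fun i => ∑ j, ‖A i j‖ ^ 2)
    (fun i _ => by positivity) (Finset.mem_univ i))
  exact Finset.single_le_sum (f := fun j => ‖A i j‖ ^ 2) (fun i _ => by positivity)
    (Finset.mem_univ j)

theorem frobNorm_le_mul_frobNorm {c : ℝ} (hc : 0 ≤ c) {A B : Matrix ι κ ℂ}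
    (h : ∀ i j, ‖A i j‖ ≤ c * ‖B i j‖) : frobNorm A ≤ c * frobNorm B := by
  rw [frobNorm, frobNorm, ← Real.sqrt_sq hc, ← Real.sqrt_mul (sq_nonneg _)]
  refine Real.sqrt_le_sqrt ?_
  simp only [Finset.mul_sum, ← mul_pow]
  gcongr
  exact h _ _

/-- The Euclidean norm of a column. -/
noncomputable def colNorm {ι κ : Type*} [Fintype ι] (A : Matrix ι κ ℂ) (j : κ) : ℝ :=
  ‖WithLp.toLp 2 (fun i => A i j)‖

theorem colNorm_sq {ι κ : Type*} [Fintype ι] (A : Matrix ι κ ℂ) (j : κ) :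
    colNorm A j ^ 2 = ∑ i, ‖A i j‖ ^ 2 := by
  rw [colNorm, EuclideanSpace.norm_sq_eq]

theorem frobNorm_sq_eq_sum_colNorm (A : Matrix ι κ ℂ) : frobNorm A ^ 2 = ∑ j, colNorm A j ^ 2 := by
  rw [frobNorm_sq, Finset.sum_comm]
  simp only [colNorm_sq]

theorem colNorm_le_frobNorm (A : Matrix ι κ ℂ) (j : κ) : colNorm A j ≤ frobNorm A := by
  refine le_of_sq_le_sq ?_ (frobNorm_nonneg _)
  rw [frobNorm_sq_eq_sum_colNorm]
  exact Finset.single_le_sum (f := fun j => colNorm A j ^ 2) (fun i _ => sq_nonneg _)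
    (Finset.mem_univ j)

theorem norm_mulVec_le [DecidableEq κ] (A : Matrix ι κ ℂ) (x : κ → ℂ) :
    ‖WithLp.toLp 2 (A *ᵥ x)‖ ≤ ‖A‖ * ‖WithLp.toLp 2 x‖ :=
  Matrix.l2_opNorm_mulVec A (WithLp.toLp 2 x)

theorem l2norm_le_of_forall [DecidableEq κ] (A : Matrix ι κ ℂ) {c : ℝ} (hc : 0 ≤ c)
    (h : ∀ x : κ → ℂ, ‖WithLp.toLp 2 (A *ᵥ x)‖ ≤ c * ‖WithLp.toLp 2 x‖) : ‖A‖ ≤ c := by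
  rw [Matrix.l2_opNorm_def]
  exact ContinuousLinearMap.opNorm_le_bound _ hc fun x => h x.ofLp

theorem colNorm_mul_le {ι κ l : Type*} [Fintype ι] [Fintype κ] [DecidableEq κ]
    (A : Matrix ι κ ℂ) (B : Matrix κ l ℂ) (j : l) :
    colNorm (A * B) j ≤ ‖A‖ * colNorm B j :=
  norm_mulVec_le A fun i => B i j

theorem frobNorm_mul_le_left [DecidableEq κ] (A : Matrix ι κ ℂ) (B : Matrix κ l ℂ) :
    frobNorm (A * B) ≤ ‖A‖ * frobNorm B := by
  refine le_of_sq_le_sq ?_ (mul_nonneg (norm_nonneg _) (frobNorm_nonneg _))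
  rw [mul_pow, frobNorm_sq_eq_sum_colNorm, frobNorm_sq_eq_sum_colNorm, Finset.mul_sum]
  gcongr with j
  rw [← mul_pow]
  exact pow_le_pow_left₀ (norm_nonneg _) (colNorm_mul_le A B j) 2

theorem frobNorm_mul_le_right [DecidableEq l] [DecidableEq κ] (A : Matrix ι κ ℂ)
    (B : Matrix κ l ℂ) : frobNorm (A * B) ≤ frobNorm A * ‖B‖ := by
  rw [← frobNorm_conjTranspose (A * B), Matrix.conjTranspose_mul, mul_comm,
    ← frobNorm_conjTranspose A, ← Matrix.l2_opNorm_conjTranspose B]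
  exact frobNorm_mul_le_left _ _

theorem l2norm_le_frobNorm [DecidableEq κ] (A : Matrix ι κ ℂ) : ‖A‖ ≤ frobNorm A := by
  refine l2norm_le_of_forall A (frobNorm_nonneg A) fun x => ?_
  have h := @Matrix.frobenius_norm_mul ι κ Unit ℂ _ _ _ _ A (Matrix.replicateCol Unit x)
  rw [← Matrix.replicateCol_mulVec, Matrix.frobenius_norm_replicateCol,
    Matrix.frobenius_norm_replicateCol] at h
  rw [frobNorm_eq_norm]
  exact h

/-- A matrix with orthonormal columns is a contraction. -/
theorem l2norm_le_one_of_isometry [DecidableEq κ] {U : Matrix ι κ ℂ} (h : Uᴴ * U = 1) :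
    ‖U‖ ≤ 1 := by
  have h1 := Matrix.l2_opNorm_conjTranspose_mul_self U
  have h2 : ‖(1 : Matrix κ κ ℂ)‖ ≤ 1 := by
    rw [← Matrix.diagonal_one, Matrix.l2_opNorm_diagonal]
    exact (pi_norm_le_iff_of_nonneg zero_le_one).2 fun i => by simp
  rw [h] at h1
  nlinarith [norm_nonneg U]

theorem norm_isometry_mulVec [DecidableEq κ] {U : Matrix ι κ ℂ} (h : Uᴴ * U = 1)
    (x : κ → ℂ) : ‖WithLp.toLp 2 (U *ᵥ x)‖ = ‖WithLp.toLp 2 x‖ := by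
  classical
  apply le_antisymm
  · have := norm_mulVec_le U x
    nlinarith [l2norm_le_one_of_isometry h, norm_nonneg (WithLp.toLp 2 x)]
  · have h1 := norm_mulVec_le Uᴴ (U *ᵥ x)
    rw [Matrix.mulVec_mulVec, h, Matrix.one_mulVec, Matrix.l2_opNorm_conjTranspose] at h1
    nlinarith [l2norm_le_one_of_isometry h, norm_nonneg (WithLp.toLp 2 (U *ᵥ x))]

end Norms

/-! ### Singular value decompositions -/

section SVD

variable {ι : Type*} [Fintype ι] [DecidableEq ι]

theorem norm_toLp_le_of_forall {κ : Type*} [Fintype κ] {a b : κ → ℂ} (h : ∀ k, ‖a k‖ ≤ ‖b k‖) :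
    ‖WithLp.toLp 2 a‖ ≤ ‖WithLp.toLp 2 b‖ := by
  rw [EuclideanSpace.norm_eq, EuclideanSpace.norm_eq]
  refine Real.sqrt_le_sqrt (Finset.sum_le_sum fun k _ => ?_)
  exact pow_le_pow_left₀ (norm_nonneg _) (h k) 2

variable {A B : Matrix ι ι ℂ} {U U' V V' : Matrix ι (Fin (Fintype.card ι)) ℂ}
  {σ σ' : Fin (Fintype.card ι) → ℝ}

theorem mul_conjTranspose_eq_one_of_isometry (h : Vᴴ * V = 1) : V * Vᴴ = 1 :=
  (Matrix.mul_eq_one_comm_of_card_eq _ _ _ (by simp)).1 h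

/-- Weyl's inequality: singular values are `1`-Lipschitz in the spectral norm. A nonzero combination
of the right singular vectors `0, …, i` of `A` that is orthogonal to the right singular vectors
`0, …, i - 1` of `B` is stretched by at least `σ i` under `A` and by at most `σ' i` under `B`. -/
theorem IsSVD.apply_le (hA : IsSVD A U σ V) (hB : IsSVD B U' σ' V') (i : Fin (Fintype.card ι)) :
    σ i ≤ σ' i + ‖A - B‖ := by
  -- Row `i` of this matrix vanishes; its kernel consists of the admissible coefficient vectors.
  set Q : Matrix (Fin (Fintype.card ι)) (Fin (Fintype.card ι)) ℂ := Matrix.of fun k l =>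
    if k < i then (V'ᴴ * V) k l else if k = i then 0 else (1 : Matrix _ _ ℂ) k l with hQ
  have hdet : Q.det = 0 := Matrix.det_eq_zero_of_row_eq_zero i fun l => by simp [hQ]
  obtain ⟨c, hc0, hc⟩ := Matrix.exists_mulVec_eq_zero_iff.2 hdet
  have hhi : ∀ k, i < k → c k = 0 := fun k hk => by
    have := congrFun hc k
    simpa [Matrix.mulVec, dotProduct, hQ, not_lt.2 hk.le, hk.ne', Matrix.one_apply] using this
  set x := V *ᵥ c with hx
  set b := V'ᴴ *ᵥ x with hb
  have hlo : ∀ k, k < i → b k = 0 := fun k hk => by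
    have := congrFun hc k
    rw [hb, hx, Matrix.mulVec_mulVec]
    simpa [Matrix.mulVec, dotProduct, hQ, hk] using this
  have hVb : V' *ᵥ b = x := by
    rw [hb, Matrix.mulVec_mulVec, mul_conjTranspose_eq_one_of_isometry hB.orthV, Matrix.one_mulVec]
  have hxc : ‖WithLp.toLp 2 x‖ = ‖WithLp.toLp 2 c‖ := norm_isometry_mulVec hA.orthV c
  have hxb : ‖WithLp.toLp 2 x‖ = ‖WithLp.toLp 2 b‖ := by
    rw [← hVb]; exact norm_isometry_mulVec hB.orthV b
  have hAx : ‖WithLp.toLp 2 (A *ᵥ x)‖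
      = ‖WithLp.toLp 2 ((Matrix.diagonal fun i => (σ i : ℂ)) *ᵥ c)‖ := by
    rw [hA.eq, hx, Matrix.mulVec_mulVec, Matrix.mul_assoc, hA.orthV, Matrix.mul_one,
      ← Matrix.mulVec_mulVec, norm_isometry_mulVec hA.orthU]
  have hBx : ‖WithLp.toLp 2 (B *ᵥ x)‖
      = ‖WithLp.toLp 2 ((Matrix.diagonal fun i => (σ' i : ℂ)) *ᵥ b)‖ := by
    rw [hB.eq, ← Matrix.mulVec_mulVec, ← Matrix.mulVec_mulVec, norm_isometry_mulVec hB.orthU]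
  have h1 : σ i * ‖WithLp.toLp 2 c‖ ≤ ‖WithLp.toLp 2 (A *ᵥ x)‖ := by
    rw [hAx]
    calc σ i * ‖WithLp.toLp 2 c‖ = ‖WithLp.toLp 2 ((σ i : ℂ) • c)‖ := by
          rw [WithLp.toLp_smul, norm_smul, Complex.norm_of_nonneg (hA.nonneg i)]
      _ ≤ _ := norm_toLp_le_of_forall fun k => by
          rw [Matrix.mulVec_diagonal]
          rcases le_or_gt k i with hk | hk
          · simp only [Pi.smul_apply, smul_eq_mul, norm_mul,
              Complex.norm_of_nonneg (hA.nonneg _)]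
            gcongr
            exact hA.anti hk
          · simp [hhi k hk]
  have h2 : ‖WithLp.toLp 2 (B *ᵥ x)‖ ≤ σ' i * ‖WithLp.toLp 2 b‖ := by
    rw [hBx]
    calc _ ≤ ‖WithLp.toLp 2 ((σ' i : ℂ) • b)‖ := norm_toLp_le_of_forall fun k => by
          rw [Matrix.mulVec_diagonal]
          rcases lt_or_ge k i with hk | hk
          · simp [hlo k hk]
          · simp only [Pi.smul_apply, smul_eq_mul, norm_mul,
              Complex.norm_of_nonneg (hB.nonneg _)]
            gcongr
            exact hB.anti hk
      _ = _ := by rw [WithLp.toLp_smul, norm_smul, Complex.norm_of_nonneg (hB.nonneg i)]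
  have h3 : ‖WithLp.toLp 2 (A *ᵥ x)‖
      ≤ ‖WithLp.toLp 2 (B *ᵥ x)‖ + ‖A - B‖ * ‖WithLp.toLp 2 x‖ := by
    have : A *ᵥ x = B *ᵥ x + (A - B) *ᵥ x := by rw [Matrix.sub_mulVec]; abel
    rw [this, WithLp.toLp_add]
    exact (norm_add_le _ _).trans (by gcongr; exact norm_mulVec_le _ _)
  have hpos : 0 < ‖WithLp.toLp 2 c‖ := by simpa using hc0
  rw [← hxb, hxc] at h2
  rw [hxc] at h3
  have : σ i * ‖WithLp.toLp 2 c‖ ≤ (σ' i + ‖A - B‖) * ‖WithLp.toLp 2 c‖ := by linarith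
  exact le_of_mul_le_mul_right this hpos

theorem IsSVD.rank_eq (hA : IsSVD A U σ V) : A.rank = Fintype.card {i // σ i ≠ 0} := by
  have hD : (Matrix.diagonal fun i => (σ i : ℂ)) = Uᴴ * A * V := by
    rw [hA.eq]
    simp only [Matrix.mul_assoc, hA.orthV, Matrix.mul_one]
    rw [← Matrix.mul_assoc, hA.orthU, Matrix.one_mul]
  have h : A.rank = (Matrix.diagonal fun i => (σ i : ℂ)).rank := by
    apply le_antisymm
    · conv_lhs => rw [hA.eq]
      exact (Matrix.rank_mul_le_left _ _).trans (Matrix.rank_mul_le_right _ _)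
    · rw [hD]
      exact (Matrix.rank_mul_le_left _ _).trans (Matrix.rank_mul_le_right _ _)
  rw [h, Matrix.rank_diagonal]
  simp

theorem IsSVD.ne_zero_iff {m : ℕ} (hA : IsSVD A U σ V) (hr : A.rank = m)
    (i : Fin (Fintype.card ι)) : σ i ≠ 0 ↔ (i : ℕ) < m := by
  rw [hA.rank_eq, Fintype.card_subtype] at hr
  constructor
  · intro hi
    have hsub : Finset.Iic i ⊆ Finset.univ.filter fun k => σ k ≠ 0 := fun k hk => by
      have h1 := hA.anti (Finset.mem_Iic.1 hk)
      have h2 := (hA.nonneg i).lt_of_ne' hi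
      simpa using (h2.trans_le h1).ne'
    have := Finset.card_le_card hsub
    rw [Fin.card_Iic] at this
    omega
  · intro hi h0
    have hsub : (Finset.univ.filter fun k => σ k ≠ 0) ⊆ Finset.Iio i := fun k hk => by
      rw [Finset.mem_Iio]
      by_contra hki
      have h1 := hA.anti (not_lt.1 hki)
      rw [h0] at h1
      exact (Finset.mem_filter.1 hk).2 (le_antisymm h1 (hA.nonneg k))
    have := Finset.card_le_card hsub
    rw [Fin.card_Iio] at this
    omega

variable {m : ℕ} (hm : m ≤ Fintype.card ι)

theorem firstCols_isometry {ι : Type*} [Fintype ι] {m N : ℕ} (hm : m ≤ N)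
    {U : Matrix ι (Fin N) ℂ} (h : Uᴴ * U = 1) :
    (firstCols hm U)ᴴ * firstCols hm U = 1 := by
  ext i j
  have := congrFun (congrFun h (Fin.castLE hm i)) (Fin.castLE hm j)
  rw [Matrix.one_apply] at this ⊢
  simp only [(Fin.castLE_injective hm).eq_iff] at this
  exact this

theorem IsSVD.mul_firstCols (hA : IsSVD A U σ V) : A * firstCols hm V =
    firstCols hm U * Matrix.diagonal fun i : Fin m => (σ (Fin.castLE hm i) : ℂ) := by
  have h : A * V = U * Matrix.diagonal fun i => (σ i : ℂ) := by
    rw [hA.eq, Matrix.mul_assoc, hA.orthV, Matrix.mul_one]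
  ext i j
  have := congrFun (congrFun h i) (Fin.castLE hm j)
  rw [Matrix.mul_diagonal] at this ⊢
  exact this

theorem IsSVD.eq_firstCols (hA : IsSVD A U σ V) (hr : A.rank = m) :
    A = firstCols hm U * (Matrix.diagonal fun i : Fin m => (σ (Fin.castLE hm i) : ℂ))
      * (firstCols hm V)ᴴ := by
  conv_lhs => rw [hA.eq]
  ext i j
  rw [Matrix.mul_apply, Matrix.mul_apply]
  simp only [Matrix.mul_diagonal]
  symm
  refine Finset.sum_of_injOn (Fin.castLE hm) (Fin.castLE_injective hm).injOn (by simp) ?_ ?_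
  · intro k _ hk
    have : σ k = 0 := by
      by_contra h
      exact hk ⟨⟨k, (hA.ne_zero_iff hr k).1 h⟩, by simp, rfl⟩
    simp [this]
  · intro k _
    rfl

end SVD

/-! ### The exact problem: Vandermonde factorization and simultaneous diagonalization -/

section Exact

/-- The Vandermonde matrix `[e^{-2πi ⟨t_j, k⟩}]` with rows indexed by the grid. -/
noncomputable def vandermonde {d m : ℕ} (n : ℕ) (t : Fin m → Fin d → ℝ) :
    Matrix (Grid d n) (Fin m) ℂ :=
  Matrix.of fun k j =>
    Complex.exp (-2 * Real.pi * Complex.I * ((∑ ℓ, t j ℓ * ((k ℓ : ℕ) : ℝ) : ℝ) : ℂ))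

theorem sampleMatrix_expSum {d m : ℕ} (n : ℕ) (t : Fin m → Fin d → ℝ) (c : Fin m → ℂ)
    (s : Fin d → ℤ) :
    sampleMatrix n (expSum t c) s = vandermonde n t * (Matrix.diagonal fun j =>
        Complex.exp (-2 * Real.pi * Complex.I * ((∑ ℓ, t j ℓ * (s ℓ : ℝ) : ℝ) : ℂ)))
      * (Matrix.diagonal c * (vandermonde n t)ᴴ) := by
  ext k h
  simp only [sampleMatrix, Matrix.of_apply, expSum]
  rw [Matrix.mul_apply]
  refine Finset.sum_congr rfl fun j _ => ?_
  rw [Matrix.mul_diagonal, Matrix.diagonal_mul, Matrix.conjTranspose_apply]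
  simp only [vandermonde, Matrix.of_apply, RCLike.star_def]
  rw [← Complex.exp_conj]
  have : ∀ a b e : ℂ, Complex.exp a * Complex.exp b * (c j * Complex.exp e)
      = c j * Complex.exp (a + b + e) := fun a b e => by rw [Complex.exp_add, Complex.exp_add]; ring
  rw [this]
  congr 2
  simp only [map_mul, map_neg, Complex.conj_ofReal, Complex.conj_I, map_ofNat]
  push_cast
  simp only [mul_add, mul_sub, Finset.sum_add_distrib, Finset.sum_sub_distrib]
  ring

theorem matT_expSum {d m : ℕ} (n : ℕ) (t : Fin m → Fin d → ℝ) (c : Fin m → ℂ) :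
    matT n (expSum t c) = vandermonde n t * (Matrix.diagonal c * (vandermonde n t)ᴴ) := by
  rw [matT, sampleMatrix_expSum]
  simp

theorem matTl_expSum {d m : ℕ} (n : ℕ) (t : Fin m → Fin d → ℝ) (c : Fin m → ℂ) (ℓ : Fin d) :
    matTl n (expSum t c) ℓ = vandermonde n t * (Matrix.diagonal fun j => node (t j) ℓ)
      * (Matrix.diagonal c * (vandermonde n t)ᴴ) := by
  rw [matTl, sampleMatrix_expSum]
  have : ∀ j, (∑ ℓ', t j ℓ' * (((Pi.single ℓ 1 : Fin d → ℤ) ℓ' : ℤ) : ℝ)) = t j ℓ := fun j => by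
    rw [Finset.sum_eq_single ℓ] <;> simp +contextual
  simp only [this, node]

/-- If `T = A * C` and `T = U Σ Vᴴ` with `Σ` invertible, then `A = U B⁻¹` for an invertible `B`,
and in the basis given by `U` every matrix `A * D * C` acts on the range of `T` through a
conjugate of `D`; the conjugating matrix does not depend on `D`. -/
theorem exists_conj_of_factorization {ι : Type*} [Fintype ι] {m : ℕ}
    {U V A : Matrix ι (Fin m) ℂ} {C : Matrix (Fin m) ι ℂ} {S : Matrix (Fin m) (Fin m) ℂ}
    (hU : Uᴴ * U = 1) (hV : Vᴴ * V = 1) (hS : IsUnit S.det) (h : A * C = U * S * Vᴴ) :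
    ∃ B : Matrix (Fin m) (Fin m) ℂ, IsUnit B.det ∧ ∀ D : Matrix (Fin m) (Fin m) ℂ,
      Uᴴ * (A * D * C) * V * S⁻¹ = B⁻¹ * D * B ∧
      A * D * C = U * (B⁻¹ * D * B) * (Uᴴ * (A * C)) := by
  set B := C * V * S⁻¹ with hB
  have hAB : A * B = U := by
    rw [hB, ← Matrix.mul_assoc, ← Matrix.mul_assoc, h, Matrix.mul_assoc (U * S), hV,
      Matrix.mul_one, Matrix.mul_nonsing_inv_cancel_right _ _ hS]
  have h1 : Uᴴ * A * B = 1 := by rw [Matrix.mul_assoc, hAB, hU]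
  have hBu : IsUnit B.det := Matrix.isUnit_det_of_left_inverse h1
  have hBi : B⁻¹ = Uᴴ * A := Matrix.inv_eq_left_inv h1
  have hA : A = U * B⁻¹ := by rw [← hAB, Matrix.mul_nonsing_inv_cancel_right _ _ hBu]
  refine ⟨B, hBu, fun D => ⟨?_, ?_⟩⟩
  · rw [hBi, hB]
    simp only [Matrix.mul_assoc]
  · have h2 : Uᴴ * (A * C) = B⁻¹ * C := by rw [hBi, Matrix.mul_assoc]
    rw [h2]
    conv_lhs => rw [hA]
    simp only [Matrix.mul_assoc, Matrix.mul_nonsing_inv_cancel_left _ _ hBu]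

/-- A matrix that diagonalizes a diagonal matrix with distinct resulting eigenvalues is
monomial, so it diagonalizes every diagonal matrix, with the same permutation of entries. -/
theorem exists_perm_of_conj_diagonal {m : ℕ} {P : Matrix (Fin m) (Fin m) ℂ} (hP : IsUnit P.det)
    {e lam : Fin m → ℂ} (hlam : Function.Injective lam)
    (h : P⁻¹ * Matrix.diagonal e * P = Matrix.diagonal lam) :
    ∃ ρ : Equiv.Perm (Fin m), ∀ f : Fin m → ℂ,
      P⁻¹ * Matrix.diagonal f * P = Matrix.diagonal fun j => f (ρ j) := by
  have h1 : Matrix.diagonal e * P = P * Matrix.diagonal lam := by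
    rw [← h, Matrix.mul_assoc, Matrix.mul_nonsing_inv_cancel_left _ _ hP]
  have h2 : ∀ i j, P i j ≠ 0 → e i = lam j := fun i j hij => by
    have := congrFun (congrFun h1 i) j
    rw [Matrix.mul_diagonal, Matrix.diagonal_mul, mul_comm] at this
    exact mul_left_cancel₀ hij this
  have h3 : ∀ j, ∃ i, P i j ≠ 0 := fun j => by
    by_contra! hj
    rw [Matrix.det_eq_zero_of_column_eq_zero j hj] at hP
    exact not_isUnit_zero hP
  choose r hr using h3
  have hinj : Function.Injective r := fun j j' hjj => by
    apply hlam
    rw [← h2 _ _ (hr j), ← h2 _ _ (hr j'), hjj]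
  have hbij := Finite.injective_iff_bijective.1 hinj
  refine ⟨Equiv.ofBijective r hbij, fun f => ?_⟩
  have h4 : Matrix.diagonal f * P = P * Matrix.diagonal fun j => f (r j) := by
    ext i j
    rw [Matrix.mul_diagonal, Matrix.diagonal_mul, mul_comm]
    by_cases hij : P i j = 0
    · simp [hij]
    · obtain ⟨j', rfl⟩ := hbij.2 i
      have : j' = j := hlam (by rw [← h2 _ _ (hr j'), h2 _ _ hij])
      rw [this]
  rw [Matrix.mul_assoc, h4, Matrix.nonsing_inv_mul_cancel_left _ _ hP]
  rfl

end Exact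

/-! ### Perturbation of the signal subspace -/

section Subspace

variable {ι : Type*} [Fintype ι] [DecidableEq ι] {m : ℕ}

theorem one_sub_mul_conjTranspose_mul_self {U : Matrix ι (Fin m) ℂ} (hU : Uᴴ * U = 1) :
    (1 - U * Uᴴ) * (1 - U * Uᴴ) = 1 - U * Uᴴ := by
  have : U * Uᴴ * (U * Uᴴ) = U * Uᴴ := by
    rw [Matrix.mul_assoc, ← Matrix.mul_assoc Uᴴ, hU, Matrix.one_mul]
  rw [Matrix.mul_sub, Matrix.mul_one, Matrix.sub_mul, Matrix.one_mul, this]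
  simp

theorem l2norm_one_sub_mul_conjTranspose_le {U : Matrix ι (Fin m) ℂ} (hU : Uᴴ * U = 1) :
    ‖1 - U * Uᴴ‖ ≤ 1 := by
  have h1 : (1 - U * Uᴴ)ᴴ = 1 - U * Uᴴ := by simp
  have h3 := Matrix.l2_opNorm_conjTranspose_mul_self (1 - U * Uᴴ)
  rw [h1, one_sub_mul_conjTranspose_mul_self hU] at h3
  nlinarith [norm_nonneg (1 - U * Uᴴ)]

theorem frobNorm_mul_mul_le {κ : Type*} [Fintype κ] {V : Matrix ι (Fin m) ℂ}
    {S : Matrix (Fin m) (Fin m) ℂ} {r : ℝ} (hV : ‖V‖ ≤ 1) (hS : ‖S‖ ≤ r) (M : Matrix κ ι ℂ) :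
    frobNorm (M * V * S) ≤ r * frobNorm M := by
  have hr : 0 ≤ r := (norm_nonneg _).trans hS
  have hM := frobNorm_nonneg M
  calc frobNorm (M * V * S) ≤ frobNorm (M * V) * ‖S‖ := frobNorm_mul_le_right _ _
    _ ≤ (frobNorm M * ‖V‖) * r :=
        mul_le_mul (frobNorm_mul_le_right _ _) hS (norm_nonneg _) (by positivity)
    _ ≤ (frobNorm M * 1) * r := by gcongr
    _ = r * frobNorm M := by ring

/-- A square matrix `X` with `X Xᴴ` close to `1` is invertible, and its inverse is bounded. -/
theorem isUnit_det_and_norm_inv_le {X : Matrix (Fin m) (Fin m) ℂ} (hX : ‖X‖ ≤ 1)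
    (h : ‖1 - X * Xᴴ‖ ≤ 1 / 2) : IsUnit X.det ∧ ‖X⁻¹‖ ≤ 2 := by
  have hu : IsUnit (1 - (1 - X * Xᴴ)) := isUnit_one_sub_of_norm_lt_one (by linarith)
  rw [sub_sub_cancel, Matrix.isUnit_iff_isUnit_det, Matrix.det_mul] at hu
  have hd := isUnit_of_mul_isUnit_left hu
  refine ⟨hd, ?_⟩
  have h1 : X⁻¹ = Xᴴ + X⁻¹ * (1 - X * Xᴴ) := by
    rw [Matrix.mul_sub, Matrix.mul_one, Matrix.nonsing_inv_mul_cancel_left _ _ hd]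
    abel
  have h2 : ‖X⁻¹‖ ≤ ‖Xᴴ‖ + ‖X⁻¹‖ * ‖1 - X * Xᴴ‖ := by
    conv_lhs => rw [h1]
    exact (norm_add_le _ _).trans (by gcongr; exact Matrix.l2_opNorm_mul _ _)
  rw [Matrix.l2_opNorm_conjTranspose] at h2
  nlinarith [norm_nonneg X⁻¹]

/-- Let `U` span the range of `T`, let `U'`, `V'` be singular vectors of the perturbed matrix `T'`
with singular values `Σ'`, and let `Q` be the inverse of `U'ᴴ U`. Then `Q` intertwines, up to an
error of first order, the compressed matrices `U'ᴴ Tl' V' Σ'⁻¹` with their exact counterparts. This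
does not involve the individual singular vectors, so no gap among the singular values enters. -/
theorem exists_intertwiner {U U' V' : Matrix ι (Fin m) ℂ} {S' : Matrix (Fin m) (Fin m) ℂ}
    {T T' : Matrix ι ι ℂ} {r : ℝ}
    (hU : Uᴴ * U = 1) (hU' : U'ᴴ * U' = 1) (hV' : V'ᴴ * V' = 1) (hT : U * (Uᴴ * T) = T)
    (hT' : T' * V' = U' * S') (hS' : IsUnit S'.det) (hr : ‖S'⁻¹‖ ≤ r)
    (hE : frobNorm (T' - T) * r ≤ 1 / 2) :
    ∃ Q : Matrix (Fin m) (Fin m) ℂ, IsUnit Q.det ∧ ‖Q⁻¹‖ ≤ 1 ∧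
      ∀ (Tl Tl' : Matrix ι ι ℂ) (S : Matrix (Fin m) (Fin m) ℂ), Tl = U * S * (Uᴴ * T) →
        frobNorm (Q * (U'ᴴ * Tl' * V' * S'⁻¹) - S * Q)
          ≤ r * (2 * frobNorm (Tl' - Tl) + 3 * ‖S‖ * frobNorm (T' - T)) := by
  have hr0 : 0 ≤ r := (norm_nonneg _).trans hr
  set e := frobNorm (T' - T) with he
  have he0 : 0 ≤ e := frobNorm_nonneg _
  have hUn := l2norm_le_one_of_isometry hU
  have hUn' := l2norm_le_one_of_isometry hU'
  have hVn' := l2norm_le_one_of_isometry hV'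
  have hUn'' : ‖U'ᴴ‖ ≤ 1 := by rwa [Matrix.l2_opNorm_conjTranspose]
  have hUnH : ‖Uᴴ‖ ≤ 1 := by rwa [Matrix.l2_opNorm_conjTranspose]
  have hUeq : U' = T' * V' * S'⁻¹ := by
    rw [hT', Matrix.mul_nonsing_inv_cancel_right _ _ hS']
  set X := U'ᴴ * U with hX
  have hXH : Xᴴ = Uᴴ * U' := by
    rw [hX, Matrix.conjTranspose_mul, Matrix.conjTranspose_conjTranspose]
  have hXn : ‖X‖ ≤ 1 := (Matrix.l2_opNorm_mul _ _).trans (mul_le_one₀ hUn'' (norm_nonneg _) hUn)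
  -- The part of `U'` orthogonal to the range of `T` is of first order.
  set Z := (1 - U * Uᴴ) * U' with hZ
  have hZeq : Z = (1 - U * Uᴴ) * ((T' - T) * V' * S'⁻¹) := by
    have h0 : (1 - U * Uᴴ) * T = 0 := by
      rw [Matrix.sub_mul, Matrix.one_mul, Matrix.mul_assoc, hT, sub_self]
    have h1 : (1 - U * Uᴴ) * (T * V' * S'⁻¹) = 0 := by
      rw [← Matrix.mul_assoc, ← Matrix.mul_assoc, h0, Matrix.zero_mul, Matrix.zero_mul]
    have h2 : (T' - T) * V' * S'⁻¹ = U' - T * V' * S'⁻¹ := by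
      rw [Matrix.sub_mul, Matrix.sub_mul, ← hUeq]
    rw [h2, Matrix.mul_sub, h1, sub_zero]
  have hZn : frobNorm Z ≤ e * r := by
    rw [hZeq]
    calc _ ≤ ‖1 - U * Uᴴ‖ * frobNorm ((T' - T) * V' * S'⁻¹) := frobNorm_mul_le_left _ _
      _ ≤ 1 * (r * e) := by
          gcongr
          · exact frobNorm_nonneg _
          · exact l2norm_one_sub_mul_conjTranspose_le hU
          · exact frobNorm_mul_mul_le hVn' hr _
      _ = e * r := by ring
  -- `1 - X Xᴴ = Zᴴ Z` is of second order.
  set D := 1 - X * Xᴴ with hD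
  have hDeq : D = Zᴴ * Z := by
    have h2 : U'ᴴ * (U * Uᴴ) * U' = X * Xᴴ := by
      rw [hX, hXH]
      simp only [Matrix.mul_assoc]
    have h3 : Zᴴ = U'ᴴ * (1 - U * Uᴴ) := by simp [hZ, Matrix.conjTranspose_mul]
    rw [h3, hZ, Matrix.mul_assoc, ← Matrix.mul_assoc (1 - U * Uᴴ) (1 - U * Uᴴ),
      one_sub_mul_conjTranspose_mul_self hU, ← Matrix.mul_assoc, Matrix.mul_sub, Matrix.sub_mul,
      Matrix.mul_one, h2, hU']
  have hDn : frobNorm D ≤ (e * r) * (1 / 2) := by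
    rw [hDeq]
    calc _ ≤ ‖Zᴴ‖ * frobNorm Z := frobNorm_mul_le_left _ _
      _ ≤ (e * r) * (e * r) := by
          rw [Matrix.l2_opNorm_conjTranspose]
          have := (l2norm_le_frobNorm Z).trans hZn
          gcongr
          exact frobNorm_nonneg _
      _ ≤ _ := by gcongr
  have hDn2 : ‖D‖ ≤ 1 / 2 := (l2norm_le_frobNorm D).trans (by linarith)
  obtain ⟨hXu, hXi⟩ := isUnit_det_and_norm_inv_le hXn hDn2
  refine ⟨X⁻¹, Matrix.isUnit_nonsing_inv_det _ hXu, ?_, ?_⟩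
  · rwa [Matrix.nonsing_inv_nonsing_inv _ hXu]
  intro Tl Tl' S hTl
  set G := (U'ᴴ * (Tl' - Tl) - X * S * Uᴴ * (T' - T)) * V' * S'⁻¹ with hG
  -- The range of `T` is spanned by `U`, so `S` enters through `Uᴴ T`; replacing `T` by `T'` there
  -- turns `Uᴴ T' V' Σ'⁻¹` into `Uᴴ U' = Xᴴ`.
  have key : U'ᴴ * Tl' * V' * S'⁻¹ = X * S * Xᴴ + G := by
    have h1 : X * S * Xᴴ = X * S * Uᴴ * T' * V' * S'⁻¹ := by
      rw [hXH]
      conv_lhs => rw [hUeq]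
      simp only [Matrix.mul_assoc]
    have h2 : U'ᴴ * Tl = X * S * Uᴴ * T := by
      rw [hTl, hX]
      simp only [Matrix.mul_assoc]
    rw [h1, hG, ← Matrix.add_mul, ← Matrix.add_mul]
    congr 2
    rw [Matrix.mul_sub, Matrix.mul_sub, h2]
    abel
  have hJ : X⁻¹ * (U'ᴴ * Tl' * V' * S'⁻¹) - S * X⁻¹ = X⁻¹ * G - S * X⁻¹ * D := by
    have h1 : S * X⁻¹ * D = S * X⁻¹ - S * Xᴴ := by
      rw [hD, Matrix.mul_sub, Matrix.mul_one, ← Matrix.mul_assoc,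
        Matrix.nonsing_inv_mul_cancel_right _ _ hXu]
    rw [key, h1, Matrix.mul_add, Matrix.mul_assoc X, Matrix.nonsing_inv_mul_cancel_left _ _ hXu]
    abel
  have hGn : frobNorm G ≤ r * (frobNorm (Tl' - Tl) + ‖S‖ * e) := by
    rw [hG]
    refine (frobNorm_mul_mul_le hVn' hr _).trans ?_
    gcongr
    refine (frobNorm_sub_le _ _).trans ?_
    gcongr
    · refine (frobNorm_mul_le_left _ _).trans ?_
      exact mul_le_of_le_one_left (frobNorm_nonneg _) hUn''
    · refine (frobNorm_mul_le_left _ _).trans ?_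
      gcongr
      calc ‖X * S * Uᴴ‖ ≤ ‖X‖ * ‖S‖ * ‖Uᴴ‖ :=
            (Matrix.l2_opNorm_mul _ _).trans (by gcongr; exact Matrix.l2_opNorm_mul _ _)
        _ ≤ 1 * ‖S‖ * 1 := by gcongr
        _ = ‖S‖ := by ring
  rw [hJ]
  calc _ ≤ frobNorm (X⁻¹ * G) + frobNorm (S * X⁻¹ * D) := frobNorm_sub_le _ _
    _ ≤ ‖X⁻¹‖ * frobNorm G + (‖S‖ * ‖X⁻¹‖) * frobNorm D := by
        refine add_le_add (frobNorm_mul_le_left _ _) ((frobNorm_mul_le_left _ _).trans ?_)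
        gcongr
        · exact frobNorm_nonneg _
        · exact Matrix.l2_opNorm_mul _ _
    _ ≤ 2 * (r * (frobNorm (Tl' - Tl) + ‖S‖ * e)) + (‖S‖ * 2) * ((e * r) * (1 / 2)) := by
        gcongr
        · exact frobNorm_nonneg _
        · exact frobNorm_nonneg _
    _ = _ := by ring

end Subspace

/-! ### Perturbation of eigenvalues and eigenvectors -/

section Eigen

variable {m : ℕ}

theorem exists_pos_forall_le {α : Type*} [Finite α] (f : α → ℝ) (hf : ∀ a, 0 < f a) :
    ∃ r : ℝ, 0 < r ∧ ∀ a, r ≤ f a := by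
  cases isEmpty_or_nonempty α
  · exact ⟨1, one_pos, fun a => isEmptyElim a⟩
  · obtain ⟨a, ha⟩ := Finite.exists_min f
    exact ⟨f a, hf a, ha⟩

/-- Continuity of simple eigenvalues: the characteristic polynomial of `diag lam + H` at `lam i`
is `∏ j, (lam i - lam' j)`; it is small, so that some factor is. -/
theorem exists_perm_eigenvalues_close (lam : Fin m → ℂ) {gap : ℝ} (hgap : 0 < gap)
    (hsep : ∀ i j, i ≠ j → gap ≤ ‖lam i - lam j‖) :
    ∃ r : ℝ, 0 < r ∧ ∀ (H Y : Matrix (Fin m) (Fin m) ℂ) (lam' : Fin m → ℂ), ‖H‖ < r →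
      IsUnit Y.det → Y * Matrix.diagonal lam' = (Matrix.diagonal lam + H) * Y →
      ∃ τ : Equiv.Perm (Fin m), ∀ i, ‖lam' (τ i) - lam i‖ < gap / 4 := by
  have hcont : ∀ i, ∃ r : ℝ, 0 < r ∧ ∀ H : Matrix (Fin m) (Fin m) ℂ, ‖H‖ < r →
      ‖(Matrix.diagonal (fun k => lam i - lam k) - H).det‖ < (gap / 4) ^ m := by
    intro i
    have hc : Continuous fun H : Matrix (Fin m) (Fin m) ℂ =>
        ‖(Matrix.diagonal (fun k => lam i - lam k) - H).det‖ := by fun_prop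
    have h0 : ‖(Matrix.diagonal (fun k => lam i - lam k) - 0).det‖ < (gap / 4) ^ m := by
      rw [sub_zero, Matrix.det_diagonal, Finset.prod_eq_zero (Finset.mem_univ i) (sub_self _)]
      simpa using by positivity
    obtain ⟨r, hr, hball⟩ := Metric.eventually_nhds_iff.1
      (hc.continuousAt.eventually_lt_const h0)
    exact ⟨r, hr, fun H hH => hball (by simpa [dist_eq_norm] using hH)⟩
  choose r hr hdet using hcont
  obtain ⟨r₀, hr₀, hle⟩ : ∃ r₀ : ℝ, 0 < r₀ ∧ ∀ i, r₀ ≤ r i :=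
    exists_pos_forall_le r hr
  refine ⟨r₀, hr₀, fun H Y lam' hH hY hYeq => ?_⟩
  have hclose : ∀ i, ∃ j, ‖lam' j - lam i‖ < gap / 4 := by
    intro i
    by_contra! hj
    have h1 : Matrix.diagonal (fun k => lam i - lam k) - H
        = Y * Matrix.diagonal (fun j => lam i - lam' j) * Y⁻¹ := by
      have e : ∀ v : Fin m → ℂ, Matrix.diagonal (fun k => lam i - v k)
          = lam i • 1 - Matrix.diagonal v := fun v => by
        ext a b
        by_cases hab : a = b
        · simp [hab]
        · simp [hab]
      rw [e, e, Matrix.mul_sub, hYeq, Matrix.sub_mul, Matrix.mul_nonsing_inv_cancel_right _ _ hY]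
      simp [Matrix.mul_nonsing_inv _ hY, sub_sub]
    have h2 := hdet i H (hH.trans_le (hle i))
    rw [h1, Matrix.det_mul, Matrix.det_mul, mul_right_comm, ← Matrix.det_mul,
      Matrix.mul_nonsing_inv _ hY, Matrix.det_one, one_mul, Matrix.det_diagonal, norm_prod] at h2
    have h3 : (gap / 4) ^ m ≤ ∏ j, ‖lam i - lam' j‖ := by
      have := Finset.prod_le_prod (s := Finset.univ) (f := fun _ : Fin m => gap / 4)
        (g := fun j => ‖lam i - lam' j‖) (fun _ _ => by positivity)
        (fun j _ => by rw [norm_sub_rev]; exact hj j)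
      simpa only [Finset.prod_const, Finset.card_univ, Fintype.card_fin] using this
    linarith
  choose τ hτ using hclose
  have hinj : Function.Injective τ := fun i i' h => by
    by_contra hne
    have h1 := hsep i i' hne
    have h2 := hτ i
    have h3 := hτ i'
    rw [← h] at h3
    have h4 : ‖lam i - lam i'‖ ≤ ‖lam' (τ i) - lam i‖ + ‖lam' (τ i) - lam i'‖ := by
      rw [norm_sub_rev (lam' (τ i)) (lam i)]
      exact norm_sub_le_norm_sub_add_norm_sub _ _ _
    linarith
  exact ⟨Equiv.ofBijective τ (Finite.injective_iff_bijective.1 hinj), hτ⟩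

/-- Perturbation of simultaneous diagonalization. Here `Y` is the matrix of the perturbed
eigenvectors in the basis of the exact ones: it intertwines `diag lam'` with `diag lam` up to `F`,
so that its off-diagonal part is of the order of `F` divided by the eigenvalue gap, while the
normalization of the columns keeps its diagonal away from zero. -/
theorem frobNorm_sub_diagonal_le {W W' Q Y F : Matrix (Fin m) (Fin m) ℂ} {lam lam' : Fin m → ℂ}
    {γ : ℝ} (hγ : 0 ≤ γ) (hsep : ∀ i j, i ≠ j → 0 < γ ∧ γ ≤ ‖lam' j - lam i‖)
    (hW : ∀ j, colNorm W j = 1) (hW' : ∀ j, colNorm W' j = 1) (hQ : IsUnit Q.det)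
    (hQi : ‖Q⁻¹‖ ≤ 1) (hY : W * Y = Q * W')
    (hF : Y * Matrix.diagonal lam' = Matrix.diagonal lam * Y + F)
    (hs : frobNorm F / γ ≤ 1 / 4) (hs' : ‖W‖ * (frobNorm F / γ) ≤ 1 / 4)
    {L G : Matrix (Fin m) (Fin m) ℂ} {z : Fin m → ℂ}
    (hG : Y * L = Matrix.diagonal z * Y + G) :
    frobNorm (L - Matrix.diagonal z)
      ≤ 2 * (2 * ‖Matrix.diagonal z‖ * (frobNorm F / γ) + frobNorm G) := by
  set D : Matrix (Fin m) (Fin m) ℂ := Matrix.diagonal fun j => Y j j with hD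
  set O := Y - D with hO
  have hYDO : Y = D + O := by rw [hO]; abel
  have hOn : frobNorm O ≤ frobNorm F / γ := by
    rw [div_eq_inv_mul]
    refine frobNorm_le_mul_frobNorm (inv_nonneg.2 hγ) fun i j => ?_
    by_cases hij : i = j
    · subst hij
      simp [hO, hD]
      positivity
    · obtain ⟨h1, h2⟩ := hsep i j hij
      have h3 := congrFun (congrFun hF i) j
      rw [Matrix.add_apply, Matrix.mul_diagonal, Matrix.diagonal_mul] at h3
      have h4 : F i j = (lam' j - lam i) * Y i j := by linear_combination -h3
      have h5 : O i j = Y i j := by simp [hO, hD, Matrix.diagonal_apply_ne _ hij]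
      rw [h5, h4, norm_mul, ← div_eq_inv_mul, le_div_iff₀ h1, mul_comm]
      gcongr
  -- Column `j` of `Q * W' = W * Y` has norm at least `1`, and it is `Y j j` times a unit vector up
  -- to the small contribution of `O`.
  have hdiag : ∀ j, 3 / 4 ≤ ‖Y j j‖ := fun j => by
    have h1 : 1 ≤ colNorm (Q * W') j := by
      have h := colNorm_mul_le Q⁻¹ (Q * W') j
      rw [Matrix.nonsing_inv_mul_cancel_left _ _ hQ, hW'] at h
      exact h.trans (mul_le_of_le_one_left (norm_nonneg _) hQi)
    have h2 : colNorm (W * Y) j ≤ ‖Y j j‖ * colNorm W j + ‖W‖ * colNorm O j := by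
      have h3 : (fun i => (W * Y) i j) = Y j j • (fun i => W i j) + fun i => (W * O) i j := by
        funext i
        conv_lhs => rw [hYDO, Matrix.mul_add]
        simp [hD, mul_comm]
      calc colNorm (W * Y) j
          = ‖WithLp.toLp 2 (Y j j • (fun i => W i j) + fun i => (W * O) i j)‖ := by rw [← h3]; rfl
        _ ≤ ‖Y j j‖ * colNorm W j + colNorm (W * O) j := by
            rw [WithLp.toLp_add, WithLp.toLp_smul]
            refine (norm_add_le _ _).trans ?_
            rw [norm_smul]
            rfl
        _ ≤ _ := by gcongr; exact colNorm_mul_le W O j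
    rw [hY, hW, mul_one] at h2
    have h4 : ‖W‖ * colNorm O j ≤ ‖W‖ * (frobNorm F / γ) := by
      gcongr
      exact (colNorm_le_frobNorm O j).trans hOn
    linarith
  have hlow : ∀ M : Matrix (Fin m) (Fin m) ℂ, frobNorm M ≤ 2 * frobNorm (Y * M) := fun M => by
    have h1 : frobNorm M ≤ 4 / 3 * frobNorm (D * M) := by
      refine frobNorm_le_mul_frobNorm (by norm_num) fun i j => ?_
      rw [hD, Matrix.diagonal_mul, norm_mul]
      nlinarith [hdiag i, norm_nonneg (M i j)]
    have h2 : frobNorm (D * M) ≤ frobNorm (Y * M) + frobNorm (O * M) := by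
      have : D * M = Y * M - O * M := by rw [← Matrix.sub_mul, hO, sub_sub_cancel]
      rw [this]
      exact frobNorm_sub_le _ _
    have h3 : frobNorm (O * M) ≤ 1 / 4 * frobNorm M := by
      refine (frobNorm_mul_le_left _ _).trans ?_
      gcongr
      · exact frobNorm_nonneg _
      · exact (l2norm_le_frobNorm O).trans (hOn.trans hs)
    linarith
  -- The diagonal part of `Y` commutes with `diagonal z`.
  have hcomm : Y * (L - Matrix.diagonal z) = Matrix.diagonal z * O - O * Matrix.diagonal z + G := by
    have h1 : Matrix.diagonal z * D = D * Matrix.diagonal z := by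
      rw [hD, Matrix.diagonal_mul_diagonal, Matrix.diagonal_mul_diagonal]
      simp only [mul_comm]
    rw [Matrix.mul_sub, hG]
    conv_lhs => rw [hYDO]
    rw [Matrix.mul_add, Matrix.add_mul, h1]
    abel
  refine (hlow _).trans ?_
  rw [hcomm]
  gcongr
  refine (frobNorm_add_le _ _).trans ?_
  gcongr
  refine (frobNorm_sub_le _ _).trans ?_
  have h1 := frobNorm_mul_le_left (Matrix.diagonal z) O
  have h2 := frobNorm_mul_le_right O (Matrix.diagonal z)
  have h3 : ‖Matrix.diagonal z‖ * frobNorm O ≤ ‖Matrix.diagonal z‖ * (frobNorm F / γ) := by gcongr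
  linarith

end Eigen

/-! ### The smallest singular value of a matrix with unit columns -/

section SigmaMin

variable {m : ℕ}

theorem colNorm_eq_one {W : Matrix (Fin m) (Fin m) ℂ} {j : Fin m}
    (h : ∑ i, ‖W i j‖ ^ 2 = 1) : colNorm W j = 1 := by
  rw [← colNorm_sq] at h
  exact (pow_eq_one_iff_of_nonneg (norm_nonneg _) two_ne_zero).1 h

theorem sigmaMin_pos (hm : 0 < m) {W : Matrix (Fin m) (Fin m) ℂ} (hW : IsUnit W.det) :
    0 < sigmaMin W := by
  refine (LinearMap.injective_iff_forall_lt_finrank_singularValues_pos _).1 ?_ _ ?_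
  · intro x y hxy
    have h : W *ᵥ x.ofLp = W *ᵥ y.ofLp := congrArg WithLp.ofLp hxy
    have := congrArg (W⁻¹ *ᵥ ·) h
    simp only [Matrix.mulVec_mulVec, Matrix.nonsing_inv_mul _ hW, Matrix.one_mulVec] at this
    exact WithLp.ofLp_injective 2 this
  · simp; omega

/-- For a matrix with unit columns the squares of the singular values add up to `m`, so the smallest
of them is at most `1`. -/
theorem sigmaMin_le_one (hm : 0 < m) {W : Matrix (Fin m) (Fin m) ℂ}
    (hW : ∀ j, ∑ i, ‖W i j‖ ^ 2 = 1) : sigmaMin W ≤ 1 := by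
  set f := Matrix.toEuclideanLin W with hf
  have hn : Module.finrank ℂ (EuclideanSpace ℂ (Fin m)) = m := by simp
  have htr := f.isSymmetric_adjoint_comp_self.re_trace_eq_sum_eigenvalues hn
  have htr' : LinearMap.trace ℂ _ (LinearMap.adjoint f ∘ₗ f) = (m : ℂ) := by
    rw [LinearMap.trace_eq_sum_inner _ (EuclideanSpace.basisFun (Fin m) ℂ)]
    have : ∀ j, inner ℂ ((EuclideanSpace.basisFun (Fin m) ℂ) j)
        ((LinearMap.adjoint f ∘ₗ f) ((EuclideanSpace.basisFun (Fin m) ℂ) j)) = 1 := fun j => by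
      rw [LinearMap.comp_apply, LinearMap.adjoint_inner_right, inner_self_eq_norm_sq_to_K,
        EuclideanSpace.basisFun_apply]
      have h1 : f (EuclideanSpace.single j 1) = WithLp.toLp 2 fun i => W i j := by
        ext i
        simp [hf, Matrix.toLpLin_apply]
      have h2 := colNorm_eq_one (hW j)
      rw [colNorm] at h2
      rw [h1, h2]
      simp
    rw [Finset.sum_congr rfl fun j _ => this j]
    simp
  have hsum : ∑ i : Fin m, f.singularValues i ^ 2 = m := by
    simp only [LinearMap.sq_singularValues_fin f hn]
    rw [htr'] at htr
    simpa using htr.symm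
  have hle : ∑ i : Fin m, sigmaMin W ^ 2 ≤ m := by
    rw [← hsum]
    refine Finset.sum_le_sum fun i _ => ?_
    exact pow_le_pow_left₀ (f.singularValues_nonneg _) (f.singularValues_antitone (by omega)) 2
  simp only [Finset.sum_const, Finset.card_univ, Fintype.card_fin, nsmul_eq_mul] at hle
  have hm' : (0 : ℝ) < m := by exact_mod_cast hm
  have : sigmaMin W ^ 2 ≤ 1 := by nlinarith
  nlinarith

end SigmaMin

/-! ### Recovery of the parameters from the nodes -/

section Parameter

/-- The recovered parameter is a Lipschitz function of the recovered node near a node off the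
positive real axis: there the representative in `[0, 1)` does not jump. -/
theorem abs_fract_log_sub_le {t a : ℝ} (ha : 0 < a) (h0 : a ≤ t) (h1 : a ≤ 1 - t) {z : ℂ}
    (hz : ‖z - Complex.exp (-2 * Real.pi * Complex.I * (t : ℂ))‖ < min a (1 / 2)) :
    |Int.fract (Complex.log z / (-2 * Real.pi * Complex.I)).re - t|
      ≤ ‖z - Complex.exp (-2 * Real.pi * Complex.I * (t : ℂ))‖ / Real.pi := by
  set e := Complex.exp (-2 * Real.pi * Complex.I * (t : ℂ)) with he
  have hen : ‖e‖ = 1 := by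
    rw [he, show (-2 * Real.pi * Complex.I * (t : ℂ)) = ((-2 * Real.pi * t : ℝ) : ℂ) * Complex.I by
      push_cast; ring]
    exact Complex.norm_exp_ofReal_mul_I _
  have he0 : e ≠ 0 := Complex.exp_ne_zero _
  set w := (z - e) / e with hw
  have hwn : ‖w‖ = ‖z - e‖ := by rw [hw, norm_div, hen, div_one]
  have hw2 : ‖w‖ ≤ 1 / 2 := by rw [hwn]; exact (hz.trans_le (min_le_right _ _)).le
  have hwa : ‖w‖ < a := by rw [hwn]; exact hz.trans_le (min_le_left _ _)
  have hzw : z = e * (1 + w) := by rw [hw]; field_simp; ring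
  have h1w : 1 + w ≠ 0 := fun h => by
    have : w = -1 := by linear_combination h
    rw [this] at hw2
    norm_num at hw2
  have hz0 : z ≠ 0 := by rw [hzw]; exact mul_ne_zero he0 h1w
  have hlog : ‖Complex.log (1 + w)‖ ≤ 2 * ‖w‖ := by
    have := Complex.norm_log_one_add_half_le_self hw2
    linarith [norm_nonneg w]
  have hexp : Complex.exp (Complex.log z)
      = Complex.exp (-2 * Real.pi * Complex.I * (t : ℂ) + Complex.log (1 + w)) := by
    rw [Complex.exp_log hz0, Complex.exp_add, Complex.exp_log h1w, ← he, hzw]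
  obtain ⟨k, hk⟩ := Complex.exp_eq_exp_iff_exists_int.1 hexp
  set q := (Complex.log (1 + w) / (-2 * Real.pi * Complex.I)).re with hq
  have hre : (Complex.log z / (-2 * Real.pi * Complex.I)).re = t + q - k := by
    have : Complex.log z / (-2 * Real.pi * Complex.I)
        = ((t - k : ℝ) : ℂ) + Complex.log (1 + w) / (-2 * Real.pi * Complex.I) := by
      rw [hk]
      have : (Real.pi : ℂ) ≠ 0 := by exact_mod_cast Real.pi_ne_zero
      push_cast
      field_simp [Complex.I_ne_zero]
      ring
    rw [this, Complex.add_re, Complex.ofReal_re, hq]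
    ring
  have hqn : |q| ≤ ‖w‖ / Real.pi := by
    refine (Complex.abs_re_le_norm _).trans ?_
    rw [norm_div]
    have : ‖(-2 * Real.pi * Complex.I : ℂ)‖ = 2 * Real.pi := by
      simp [abs_of_pos Real.pi_pos]
    rw [this, div_le_div_iff₀ (by positivity) Real.pi_pos]
    nlinarith [Real.pi_pos, norm_nonneg w]
  have hqa : |q| < a := by
    refine hqn.trans_lt (lt_of_le_of_lt ?_ hwa)
    exact div_le_self (norm_nonneg _) (by linarith [Real.pi_gt_three])
  have hqa' := abs_lt.1 hqa
  have hfract : Int.fract (Complex.log z / (-2 * Real.pi * Complex.I)).re = t + q := by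
    rw [hre, Int.fract_sub_intCast]
    exact Int.fract_eq_self.2 ⟨by linarith, by linarith⟩
  rw [hfract, add_sub_cancel_left, ← hwn]
  exact hqn

theorem eta_le {d m : ℕ} (t : Fin m → Fin d → ℝ) (j : Fin m) (ℓ : Fin d) :
    eta t ≤ |(node (t j) ℓ).re * (node (t j) ℓ).im| :=
  ciInf_le ⟨0, by rintro _ ⟨p, rfl⟩; positivity⟩ (j, ℓ)

theorem norm_node {d : ℕ} (t : Fin d → ℝ) (ℓ : Fin d) : ‖node t ℓ‖ = 1 := by
  rw [node, show (-2 * Real.pi * Complex.I * (t ℓ : ℂ)) = ((-2 * Real.pi * t ℓ : ℝ) : ℂ) * Complex.I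
    by push_cast; ring]
  exact Complex.norm_exp_ofReal_mul_I _

theorem abs_re_mul_im_node_le_one {d : ℕ} (t : Fin d → ℝ) (ℓ : Fin d) :
    |(node t ℓ).re * (node t ℓ).im| ≤ 1 := by
  rw [abs_mul]
  have h1 := Complex.abs_re_le_norm (node t ℓ)
  have h2 := Complex.abs_im_le_norm (node t ℓ)
  rw [norm_node] at h1 h2
  exact mul_le_one₀ h1 (abs_nonneg _) h2

theorem pos_of_eta_pos {d m : ℕ} {t : Fin m → Fin d → ℝ} (ht : ∀ j i, t j i ∈ Set.Ico (0 : ℝ) 1)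
    (h : 0 < eta t) (j : Fin m) (ℓ : Fin d) : 0 < t j ℓ := by
  refine (ht j ℓ).1.lt_of_ne' fun h0 => ?_
  have := h.trans_le (eta_le t j ℓ)
  simp [node, h0] at this

end Parameter

/-! ### Exact and perturbed runs -/

section Samples

variable {d n : ℕ} {f f' : (Fin d → ℤ) → ℂ} {ε : ℝ}

theorem frobNorm_matT_sub_le (hε : 0 ≤ ε)
    (h : ∀ k ∈ samplePoints d n, ‖f' k - f k‖ ≤ ε * ‖f k‖) :
    frobNorm (matT n f' - matT n f) ≤ ε * frobNorm (matT n f) := by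
  refine frobNorm_le_mul_frobNorm hε fun i j => h _ ⟨i, j, Or.inl ?_⟩
  simp

theorem frobNorm_matTl_sub_le (hε : 0 ≤ ε)
    (h : ∀ k ∈ samplePoints d n, ‖f' k - f k‖ ≤ ε * ‖f k‖) (ℓ : Fin d) :
    frobNorm (matTl n f' ℓ - matTl n f ℓ) ≤ ε * frobNorm (matTl n f ℓ) :=
  frobNorm_le_mul_frobNorm hε fun i j => h _ ⟨i, j, Or.inr ⟨ℓ, rfl⟩⟩

end Samples

namespace Run

variable {d n m : ℕ} {μ : Fin d → ℂ} {f f' : (Fin d → ℤ) → ℂ}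

theorem svLast_le (R : Run n m μ f) (i : Fin m) : R.svLast ≤ R.sv i :=
  ciInf_le (Set.finite_range _).bddBelow i

theorem exists_svLast_eq (hm : 0 < m) (R : Run n m μ f) : ∃ i, R.svLast = R.sv i := by
  have : Nonempty (Fin m) := ⟨⟨0, hm⟩⟩
  obtain ⟨i, hi⟩ := exists_eq_ciInf_of_finite (f := R.sv)
  exact ⟨i, hi.symm⟩

/-- The diagonal matrix of the `m` largest singular values. -/
noncomputable def sigmaMat (R : Run n m μ f) : Matrix (Fin m) (Fin m) ℂ :=
  Matrix.diagonal fun i : Fin m => (R.σ (Fin.castLE R.hm i) : ℂ)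

theorem isUnit_det_sigmaMat {R : Run n m μ f} (h : 0 < R.svLast) : IsUnit R.sigmaMat.det := by
  rw [sigmaMat, Matrix.det_diagonal, isUnit_iff_ne_zero, Finset.prod_ne_zero_iff]
  intro i _
  exact_mod_cast (h.trans_le (R.svLast_le i)).ne'

theorem norm_inv_sigmaMat_le {R : Run n m μ f} (h : 0 < R.svLast) :
    ‖R.sigmaMat⁻¹‖ ≤ 1 / R.svLast := by
  have hi : R.sigmaMat⁻¹ = Matrix.diagonal fun i : Fin m => ((R.sv i)⁻¹ : ℂ) := by
    refine Matrix.inv_eq_left_inv ?_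
    rw [sigmaMat, Matrix.diagonal_mul_diagonal, ← Matrix.diagonal_one]
    congr 1
    funext i
    have : (R.sv i : ℂ) ≠ 0 := by exact_mod_cast (h.trans_le (R.svLast_le i)).ne'
    exact inv_mul_cancel₀ this
  rw [hi, Matrix.l2_opNorm_diagonal, pi_norm_le_iff_of_nonneg (by positivity)]
  intro i
  have h1 := R.svLast_le i
  rw [norm_inv, Complex.norm_of_nonneg (h.le.trans h1), one_div]
  gcongr

theorem svLast_sub_le (hm : 0 < m) (R : Run n m μ f) (R' : Run n m μ f') :
    R.svLast - frobNorm (matT n f' - matT n f) ≤ R'.svLast := by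
  obtain ⟨i, hi⟩ := R'.exists_svLast_eq hm
  have h1 := R.svd.apply_le R'.svd (Fin.castLE R.hm i)
  have h2 := l2norm_le_frobNorm (matT n f' - matT n f)
  rw [norm_sub_rev] at h2
  have h3 := R.svLast_le i
  rw [hi]
  simp only [sv] at *
  linarith

theorem svLast_le_frobNorm (hm : 0 < m) (R : Run n m μ f) : R.svLast ≤ frobNorm (matT n f) := by
  have h1 := R.svLast_le ⟨0, hm⟩
  refine h1.trans ?_
  set i := Fin.castLE R.hm ⟨0, hm⟩ with hi
  have hD : (Matrix.diagonal fun i => (R.σ i : ℂ)) = R.Uᴴ * (matT n f * R.V) := by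
    conv_rhs => rw [R.svd.eq]
    simp only [Matrix.mul_assoc, R.svd.orthV, Matrix.mul_one]
    rw [← Matrix.mul_assoc, R.svd.orthU, Matrix.one_mul]
  have h2 : frobNorm (R.Uᴴ * (matT n f * R.V)) ≤ frobNorm (matT n f) := by
    have h3 : ‖R.Uᴴ‖ ≤ 1 := by
      rw [Matrix.l2_opNorm_conjTranspose]
      exact l2norm_le_one_of_isometry R.svd.orthU
    have h4 := l2norm_le_one_of_isometry R.svd.orthV
    have h5 := frobNorm_nonneg (matT n f)
    calc _ ≤ ‖R.Uᴴ‖ * frobNorm (matT n f * R.V) := frobNorm_mul_le_left _ _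
      _ ≤ frobNorm (matT n f * R.V) := mul_le_of_le_one_left (frobNorm_nonneg _) h3
      _ ≤ frobNorm (matT n f) * ‖R.V‖ := frobNorm_mul_le_right _ _
      _ ≤ _ := mul_le_of_le_one_right h5 h4
  refine le_trans ?_ h2
  rw [← hD]
  have h6 := norm_apply_le_frobNorm (Matrix.diagonal fun i => (R.σ i : ℂ)) i i
  rw [Matrix.diagonal_apply_eq, Complex.norm_of_nonneg (R.svd.nonneg i)] at h6
  exact h6

theorem deltaMin_le_svLast (hm : 0 < m) (R : Run n m μ f) (R' : Run n m μ f') :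
    deltaMin R R' ≤ R.svLast := by
  obtain ⟨i, hi⟩ := R.exists_svLast_eq hm
  rw [hi]
  refine (ciInf_le (Set.finite_range _).bddBelow i).trans (csInf_le ⟨0, ?_⟩ (Or.inl rfl))
  rintro x (rfl | ⟨j, -, rfl⟩)
  · exact R.svd.nonneg _
  · exact abs_nonneg _

/-- The compressed matrix `S_ℓ` of a run. -/
noncomputable def S (R : Run n m μ f) (ℓ : Fin d) : Matrix (Fin m) (Fin m) ℂ :=
  matS R.hm R.U R.σ R.V (matTl n f ℓ)

theorem norm_S_le {R : Run n m μ f} (h : 0 < R.svLast) (ℓ : Fin d) :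
    ‖R.S ℓ‖ ≤ frobNorm (matTl n f ℓ) / R.svLast := by
  have hU : ‖(firstCols R.hm R.U)ᴴ‖ ≤ 1 := by
    rw [Matrix.l2_opNorm_conjTranspose]
    exact l2norm_le_one_of_isometry (firstCols_isometry _ R.svd.orthU)
  have hV := l2norm_le_one_of_isometry (firstCols_isometry R.hm R.svd.orthV)
  refine (l2norm_le_frobNorm _).trans ?_
  refine (frobNorm_mul_mul_le hV (norm_inv_sigmaMat_le h) _).trans ?_
  rw [one_div_mul_eq_div]
  gcongr
  exact (frobNorm_mul_le_left _ _).trans (mul_le_of_le_one_left (frobNorm_nonneg _) hU)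

theorem svLast_pos (hm : 0 < m) (R : Run n m μ f) (hr : (matT n f).rank = m) : 0 < R.svLast := by
  obtain ⟨i, hi⟩ := R.exists_svLast_eq hm
  rw [hi]
  exact (R.svd.nonneg _).lt_of_ne' ((R.svd.ne_zero_iff hr _).2 i.2)

/-- The structure of an exact run: in the basis of the left singular vectors, every `T_ℓ` acts
through the matrix `S_ℓ`, and `W` diagonalizes all `S_ℓ` simultaneously. -/
theorem exists_perm_diagonalized_eq (hm : 0 < m) {t : Fin m → Fin d → ℝ} {c : Fin m → ℂ}
    (hr : (matT n (expSum t c)).rank = m) (R : Run n m μ (expSum t c))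
    (hlam : Function.Injective R.lam) :
    ∃ ρ : Equiv.Perm (Fin m),
      (∀ ℓ, R.diagonalized ℓ = Matrix.diagonal fun j => node (t (ρ j)) ℓ) ∧
      (∀ ℓ, matTl n (expSum t c) ℓ = firstCols R.hm R.U * R.S ℓ *
        ((firstCols R.hm R.U)ᴴ * matT n (expSum t c))) ∧
      firstCols R.hm R.U * ((firstCols R.hm R.U)ᴴ * matT n (expSum t c))
        = matT n (expSum t c) := by
  have hT := R.svd.eq_firstCols R.hm hr
  have hU := firstCols_isometry R.hm R.svd.orthU
  have hV := firstCols_isometry R.hm R.svd.orthV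
  have hT' := hT
  conv_lhs at hT' => rw [matT_expSum]
  obtain ⟨B, hB, hBD⟩ := exists_conj_of_factorization hU hV
    (isUnit_det_sigmaMat (R.svLast_pos hm hr)) hT'
  rw [← matT_expSum] at hBD
  have hS : ∀ ℓ, R.S ℓ = B⁻¹ * (Matrix.diagonal fun j => node (t j) ℓ) * B := fun ℓ => by
    have h := (hBD (Matrix.diagonal fun j => node (t j) ℓ)).1
    rw [← matTl_expSum] at h
    exact h
  have hconj : ∀ v : Fin m → ℂ, R.W⁻¹ * (B⁻¹ * Matrix.diagonal v * B) * R.W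
      = (B * R.W)⁻¹ * Matrix.diagonal v * (B * R.W) := fun v => by
    rw [Matrix.mul_inv_rev]
    simp only [Matrix.mul_assoc]
  have hsum : ∑ ℓ, μ ℓ • R.S ℓ
      = B⁻¹ * Matrix.diagonal (fun j => ∑ ℓ, μ ℓ * node (t j) ℓ) * B := by
    have : Matrix.diagonal (fun j => ∑ ℓ, μ ℓ * node (t j) ℓ)
        = ∑ ℓ, μ ℓ • Matrix.diagonal fun j => node (t j) ℓ := by
      ext i j
      rw [Matrix.sum_apply]
      by_cases hij : i = j
      · simp [hij]
      · simp [hij]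
    rw [this, Matrix.mul_sum, Matrix.sum_mul]
    simp [hS]
  obtain ⟨ρ, hρ⟩ := exists_perm_of_conj_diagonal (P := B * R.W)
    (by rw [Matrix.det_mul]; exact hB.mul R.W_unit) hlam (by
      rw [← hconj, ← hsum]
      exact R.W_diag)
  refine ⟨ρ, fun ℓ => ?_, fun ℓ => ?_, ?_⟩
  · have h := hρ fun j => node (t j) ℓ
    rw [← hconj, ← hS] at h
    exact h
  · have h := (hBD (Matrix.diagonal fun j => node (t j) ℓ)).2
    rw [← matTl_expSum, ← hS] at h
    exact h
  · conv_lhs => rw [hT]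
    rw [← Matrix.mul_assoc (firstCols R.hm R.U)ᴴ, ← Matrix.mul_assoc (firstCols R.hm R.U)ᴴ, hU,
      Matrix.one_mul, ← Matrix.mul_assoc]
    exact hT.symm

end Run

/-! ### From an approximate intertwiner to the error bound -/

section Assembly

theorem frobNorm_eq_sqrt_of_colNorm {m : ℕ} {W : Matrix (Fin m) (Fin m) ℂ}
    (hW : ∀ j, colNorm W j = 1) : frobNorm W = Real.sqrt m := by
  rw [← Real.sqrt_sq (frobNorm_nonneg W), frobNorm_sq_eq_sum_colNorm]
  simp [hW]

/-- A weighted sum with weights of Euclidean norm `1` is bounded by `√d` times the largest term. -/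
theorem frobNorm_weighted_sum_le {d m : ℕ} {μ : Fin d → ℂ} (hμ : ∑ ℓ, ‖μ ℓ‖ ^ 2 = 1)
    {J : Fin d → Matrix (Fin m) (Fin m) ℂ} {p : ℝ} (hp : 0 ≤ p) (hJ : ∀ ℓ, frobNorm (J ℓ) ≤ p) :
    frobNorm (∑ ℓ, μ ℓ • J ℓ) ≤ Real.sqrt d * p := by
  have h1 : ∑ ℓ, ‖μ ℓ‖ ≤ Real.sqrt d := by
    refine Real.le_sqrt_of_sq_le ?_
    have := sq_sum_le_card_mul_sum_sq (s := Finset.univ) (f := fun ℓ => ‖μ ℓ‖)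
    rw [hμ] at this
    simpa using this
  calc _ ≤ ∑ ℓ, frobNorm (μ ℓ • J ℓ) := frobNorm_sum_le _ _
    _ ≤ ∑ ℓ, ‖μ ℓ‖ * p := by
        gcongr with ℓ
        rw [frobNorm_smul]
        gcongr
        exact hJ ℓ
    _ = (∑ ℓ, ‖μ ℓ‖) * p := by rw [Finset.sum_mul]
    _ ≤ _ := by gcongr

theorem submatrix_conj {m : ℕ} (W S : Matrix (Fin m) (Fin m) ℂ) (τ : Equiv.Perm (Fin m)) :
    (W⁻¹ * S * W).submatrix τ τ = (W.submatrix id τ)⁻¹ * S * W.submatrix id τ := by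
  have : (W.submatrix id τ)⁻¹ = W⁻¹.submatrix τ id := by
    have := Matrix.inv_submatrix_equiv W (Equiv.refl _) τ
    exact this
  rw [this]
  rfl

theorem colNorm_submatrix {m : ℕ} (W : Matrix (Fin m) (Fin m) ℂ) (τ : Equiv.Perm (Fin m))
    (j : Fin m) : colNorm (W.submatrix id τ) j = colNorm W (τ j) := rfl

/-- The error bound for one simultaneously diagonalized matrix `S`, given an approximate
intertwiner `Q` between the exact and the perturbed matrices. -/
theorem frobNorm_conj_sub_diagonal_le {m : ℕ} {W W' Q Sμ Sμ' S S' : Matrix (Fin m) (Fin m) ℂ}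
    {lam lam' z : Fin m → ℂ} {γ p q : ℝ} (hγ : 0 ≤ γ)
    (hsep : ∀ i j, i ≠ j → 0 < γ ∧ γ ≤ ‖lam' j - lam i‖)
    (hWu : IsUnit W.det) (hWu' : IsUnit W'.det)
    (hW : ∀ j, colNorm W j = 1) (hW' : ∀ j, colNorm W' j = 1) (hQ : IsUnit Q.det)
    (hQi : ‖Q⁻¹‖ ≤ 1)
    (hμ : W⁻¹ * Sμ * W = Matrix.diagonal lam) (hμ' : W'⁻¹ * Sμ' * W' = Matrix.diagonal lam')
    (hz : W⁻¹ * S * W = Matrix.diagonal z)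
    (hq : frobNorm (Q * Sμ' - Sμ * Q) ≤ q) (hp : frobNorm (Q * S' - S * Q) ≤ p)
    (hs : Real.sqrt m * ‖W⁻¹‖ * q / γ ≤ 1 / 4)
    (hs' : ‖W‖ * (Real.sqrt m * ‖W⁻¹‖ * q / γ) ≤ 1 / 4) :
    frobNorm (W'⁻¹ * S' * W' - Matrix.diagonal z)
      ≤ 2 * (2 * ‖Matrix.diagonal z‖ * (Real.sqrt m * ‖W⁻¹‖ * q / γ)
        + Real.sqrt m * ‖W⁻¹‖ * p) := by
  have hWn' : ‖W'‖ ≤ Real.sqrt m :=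
    (l2norm_le_frobNorm W').trans (frobNorm_eq_sqrt_of_colNorm hW').le
  have hbound : ∀ {J : Matrix (Fin m) (Fin m) ℂ} {r : ℝ}, frobNorm J ≤ r →
      frobNorm (W⁻¹ * J * W') ≤ Real.sqrt m * ‖W⁻¹‖ * r := fun {J r} h => by
    have h0 := frobNorm_nonneg J
    calc _ ≤ frobNorm (W⁻¹ * J) * ‖W'‖ := frobNorm_mul_le_right _ _
      _ ≤ (‖W⁻¹‖ * frobNorm J) * Real.sqrt m :=
          mul_le_mul (frobNorm_mul_le_left _ _) hWn' (norm_nonneg _) (by positivity)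
      _ ≤ (‖W⁻¹‖ * r) * Real.sqrt m := by gcongr
      _ = _ := by ring
  set Y := W⁻¹ * Q * W' with hY
  have hinter : ∀ {A A' D D' : Matrix (Fin m) (Fin m) ℂ}, W⁻¹ * A * W = D → W'⁻¹ * A' * W' = D' →
      Y * D' = D * Y + W⁻¹ * (Q * A' - A * Q) * W' := fun {A A' D D'} h h' => by
    rw [← h, ← h', hY, Matrix.mul_sub, Matrix.sub_mul]
    simp only [Matrix.mul_assoc]
    rw [Matrix.mul_nonsing_inv_cancel_left _ _ hWu, Matrix.mul_nonsing_inv_cancel_left _ _ hWu']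
    abel
  have hWY : W * Y = Q * W' := by
    rw [hY, Matrix.mul_assoc, Matrix.mul_nonsing_inv_cancel_left _ _ hWu]
  have hFq : frobNorm (W⁻¹ * (Q * Sμ' - Sμ * Q) * W') / γ ≤ Real.sqrt m * ‖W⁻¹‖ * q / γ := by
    gcongr
    exact hbound hq
  refine (frobNorm_sub_diagonal_le hγ hsep hW hW' hQ hQi hWY (hinter hμ hμ') (hFq.trans hs)
    (le_trans (by gcongr) hs') (hinter hz rfl)).trans ?_
  gcongr
  exact hbound hp

/-- The matching of the eigenvalues, for an approximate intertwiner `Q`. -/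
theorem exists_perm_of_intertwiner {m : ℕ} (lam : Fin m → ℂ) {gap : ℝ} (hgap : 0 < gap)
    (hsep : ∀ i j, i ≠ j → gap ≤ ‖lam i - lam j‖) {W Sμ : Matrix (Fin m) (Fin m) ℂ}
    (hWu : IsUnit W.det) (hμ : W⁻¹ * Sμ * W = Matrix.diagonal lam) :
    ∃ r : ℝ, 0 < r ∧ ∀ (W' Q Sμ' : Matrix (Fin m) (Fin m) ℂ) (lam' : Fin m → ℂ),
      IsUnit W'.det → IsUnit Q.det → ‖Q⁻¹‖ ≤ 1 → W'⁻¹ * Sμ' * W' = Matrix.diagonal lam' →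
      ‖W⁻¹‖ * frobNorm (Q * Sμ' - Sμ * Q) * ‖W‖ < r →
      ∃ τ : Equiv.Perm (Fin m), ∀ i, ‖lam' (τ i) - lam i‖ < gap / 4 := by
  obtain ⟨r, hr, h⟩ := exists_perm_eigenvalues_close lam hgap hsep
  refine ⟨r, hr, fun W' Q Sμ' lam' hWu' hQ hQi hμ' hlt => ?_⟩
  refine h (W⁻¹ * (Q * Sμ' - Sμ * Q) * Q⁻¹ * W) (W⁻¹ * Q * W') lam' ?_ ?_ ?_
  · refine lt_of_le_of_lt ?_ hlt
    set J := Q * Sμ' - Sμ * Q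
    calc _ ≤ ‖W⁻¹ * J * Q⁻¹‖ * ‖W‖ := Matrix.l2_opNorm_mul _ _
      _ ≤ (‖W⁻¹ * J‖ * ‖Q⁻¹‖) * ‖W‖ := by gcongr; exact Matrix.l2_opNorm_mul _ _
      _ ≤ ((‖W⁻¹‖ * ‖J‖) * 1) * ‖W‖ := by
          gcongr
          exact Matrix.l2_opNorm_mul _ _
      _ ≤ ((‖W⁻¹‖ * frobNorm J) * 1) * ‖W‖ := by
          gcongr
          exact l2norm_le_frobNorm J
      _ = _ := by ring
  · rw [Matrix.det_mul, Matrix.det_mul]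
    exact ((Matrix.isUnit_nonsing_inv_det _ hWu).mul hQ).mul hWu'
  · rw [← hμ, ← hμ']
    simp only [Matrix.mul_sub, Matrix.sub_mul, Matrix.add_mul, Matrix.mul_assoc]
    rw [Matrix.mul_nonsing_inv_cancel_left _ _ hWu, Matrix.mul_nonsing_inv_cancel_left _ _ hWu',
      Matrix.nonsing_inv_mul_cancel_left _ _ hQ]
    abel

/-- The bound obtained from `frobNorm_conj_sub_diagonal_le` is at most `ε` times `errorCoeff 7`. Of
the gap `δ` only `δ ≤ s` is needed. The value `7` comes from `12 √m ≤ 1 + 4 √2 + (2 + g) √(2 m)`,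
which holds for it because `√2 ≥ 4 / 3`. -/
theorem bound_le_coeff {m d ε Λ γ s s' δ σ M N w κ : ℝ} (hm : 1 ≤ m) (hε : 0 ≤ ε)
    (hΛ : 0 ≤ Λ) (hγ : 0 ≤ γ) (hδ : 0 < δ) (hδs : δ ≤ s) (hs' : 0 < s') (hσ : 0 < σ)
    (hσ1 : σ ≤ 1) (hM : 0 ≤ M) (hsN : s ≤ N) (hw : 0 ≤ w) (hwκ : w ≤ κ) :
    2 * (2 * Λ * (Real.sqrt m * w * (Real.sqrt d * (ε * (3 * (1 / s') * M * (1 + N / s)))) / γ)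
        + Real.sqrt m * w * (ε * (3 * (1 / s') * M * (1 + N / s))))
      ≤ ε * ((2 * Real.sqrt (m * d) * Λ / (γ * s' * σ) + 1 / s')
        * (1 + (1 + 4 * Real.sqrt 2 + (2 + 7) * Real.sqrt (2 * m)) * N / δ) * M * κ) := by
  have hs : 0 < s := hδ.trans_le hδs
  have hN : 0 < N := hs.trans_le hsN
  have hsm : 1 ≤ Real.sqrt m := Real.one_le_sqrt.2 hm
  have h1 : 6 * Real.sqrt m * (1 + N / s)
      ≤ 1 + (1 + 4 * Real.sqrt 2 + (2 + 7) * Real.sqrt (2 * m)) * N / δ := by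
    have h2 : N / s ≤ N / δ := by gcongr
    have h3 : 1 ≤ N / s := (one_le_div hs).2 hsN
    have h4 : Real.sqrt (2 * m) = Real.sqrt 2 * Real.sqrt m := Real.sqrt_mul (by norm_num) _
    have h5 : (4 / 3 : ℝ) ≤ Real.sqrt 2 := Real.le_sqrt_of_sq_le (by norm_num)
    have h6 : 12 * Real.sqrt m ≤ 1 + 4 * Real.sqrt 2 + (2 + 7) * Real.sqrt (2 * m) := by
      rw [h4]
      nlinarith
    calc 6 * Real.sqrt m * (1 + N / s) ≤ 6 * Real.sqrt m * (N / δ + N / δ) := by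
          gcongr
          linarith
      _ = 12 * Real.sqrt m * (N / δ) := by ring
      _ ≤ (1 + 4 * Real.sqrt 2 + (2 + 7) * Real.sqrt (2 * m)) * (N / δ) := by gcongr
      _ ≤ _ := by rw [mul_div_assoc]; linarith
  have h2 : 2 * Real.sqrt d * Λ / (γ * s') ≤ 2 * Real.sqrt (m * d) * Λ / (γ * s' * σ) := by
    rcases hγ.eq_or_lt with h0 | h0
    · simp [← h0]
    · have h3 : Real.sqrt d ≤ Real.sqrt (m * d) := by
        rw [Real.sqrt_mul (by linarith)]
        exact le_mul_of_one_le_left (Real.sqrt_nonneg _) hsm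
      have h4 : γ * s' * σ ≤ γ * s' := mul_le_of_le_one_right (by positivity) hσ1
      gcongr
  calc _ = ε * ((2 * Real.sqrt d * Λ / (γ * s') + 1 / s')
        * (6 * Real.sqrt m * (1 + N / s)) * M * w) := by
        rw [show γ * s' = s' * γ by ring, ← div_div]
        ring
    _ ≤ _ := by gcongr

end Assembly

/-! ### The error bound for a run -/

section RunPerturbation

variable {d n m : ℕ} {μ : Fin d → ℂ} {f f' : (Fin d → ℤ) → ℂ}

/-- The approximate intertwiner for two runs, with an error in terms of the relative perturbation
`ε` of the samples. -/
theorem Run.exists_intertwiner {R : Run n m μ f} {R' : Run n m μ f'} {ε : ℝ} (hε : 0 ≤ ε)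
    (hs : 0 < R.svLast) (hs' : 0 < R'.svLast)
    (hTl : ∀ ℓ, matTl n f ℓ = firstCols R.hm R.U * R.S ℓ * ((firstCols R.hm R.U)ᴴ * matT n f))
    (hT : firstCols R.hm R.U * ((firstCols R.hm R.U)ᴴ * matT n f) = matT n f)
    (hf : ∀ k ∈ samplePoints d n, ‖f' k - f k‖ ≤ ε * ‖f k‖)
    (hE : ε * frobNorm (matT n f) * (1 / R'.svLast) ≤ 1 / 2) :
    ∃ Q : Matrix (Fin m) (Fin m) ℂ, IsUnit Q.det ∧ ‖Q⁻¹‖ ≤ 1 ∧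
      ∀ ℓ, frobNorm (Q * R'.S ℓ - R.S ℓ * Q) ≤ ε * (3 * (1 / R'.svLast)
        * (⨆ ℓ, frobNorm (matTl n f ℓ)) * (1 + frobNorm (matT n f) / R.svLast)) := by
  have hET := frobNorm_matT_sub_le (n := n) hε hf
  obtain ⟨Q, hQ, hQi, h⟩ := Prony.exists_intertwiner (firstCols_isometry R.hm R.svd.orthU)
    (firstCols_isometry R'.hm R'.svd.orthU) (firstCols_isometry R'.hm R'.svd.orthV) hT
    (R'.svd.mul_firstCols R'.hm) (Run.isUnit_det_sigmaMat hs') (Run.norm_inv_sigmaMat_le hs')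
    (le_trans (by gcongr) hE)
  refine ⟨Q, hQ, hQi, fun ℓ => (h _ _ _ (hTl ℓ)).trans ?_⟩
  set M := ⨆ ℓ, frobNorm (matTl n f ℓ) with hM
  have hMl : frobNorm (matTl n f ℓ) ≤ M :=
    le_ciSup (f := fun ℓ => frobNorm (matTl n f ℓ)) (Set.finite_range _).bddAbove ℓ
  have hM0 : 0 ≤ M := (frobNorm_nonneg _).trans hMl
  have hEl : frobNorm (matTl n f' ℓ - matTl n f ℓ) ≤ ε * M :=
    (frobNorm_matTl_sub_le hε hf ℓ).trans (by gcongr)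
  have hSn : ‖R.S ℓ‖ ≤ M / R.svLast := (Run.norm_S_le hs ℓ).trans (by gcongr)
  have hE0 := frobNorm_nonneg (matT n f' - matT n f)
  calc _ ≤ 1 / R'.svLast * (2 * (ε * M) + 3 * (M / R.svLast) * (ε * frobNorm (matT n f))) := by
        gcongr
    _ ≤ 1 / R'.svLast * (3 * (ε * M) + 3 * (M / R.svLast) * (ε * frobNorm (matT n f))) := by
        gcongr
        norm_num
    _ = _ := by ring

theorem gammaGap_nonneg (R : Run n m μ f) (R' : Run n m μ f') (τ : Equiv.Perm (Fin m)) :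
    0 ≤ gammaGap R R' τ := by
  refine Real.sInf_nonneg ?_
  rintro x ⟨i, j, -, rfl⟩
  exact norm_nonneg _

theorem gammaGap_le (R : Run n m μ f) (R' : Run n m μ f') (τ : Equiv.Perm (Fin m)) {i j : Fin m}
    (h : j ≠ i) : gammaGap R R' τ ≤ ‖R.lam j - R'.lam (τ i)‖ := by
  refine csInf_le ⟨0, ?_⟩ ⟨i, j, h, rfl⟩
  rintro x ⟨i, j, -, rfl⟩
  exact norm_nonneg _

theorem le_gammaGap {R : Run n m μ f} {R' : Run n m μ f'} {τ : Equiv.Perm (Fin m)} {a : ℝ}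
    (h : ∀ i j, j ≠ i → a ≤ ‖R.lam j - R'.lam (τ i)‖) {i j : Fin m} (hij : j ≠ i) :
    a ≤ gammaGap R R' τ := by
  refine le_csInf ⟨_, i, j, hij, rfl⟩ ?_
  rintro x ⟨i, j, hij, rfl⟩
  exact h i j hij

/-- For `m = 1` the gap is `0`, and the inequality holds because the inverse of `0` is `0`. -/
theorem inv_gammaGap_le {R : Run n m μ f} {R' : Run n m μ f'} {τ : Equiv.Perm (Fin m)} {a : ℝ}
    (ha : 0 < a) (h : ∀ i j, j ≠ i → a ≤ ‖R.lam j - R'.lam (τ i)‖) :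
    (gammaGap R R' τ)⁻¹ ≤ a⁻¹ := by
  by_cases hm : ∃ i j : Fin m, j ≠ i
  · obtain ⟨i, j, hij⟩ := hm
    have := le_gammaGap h hij
    gcongr
  · have : gammaGap R R' τ = 0 := by
      unfold gammaGap
      convert Real.sInf_empty
      refine Set.eq_empty_of_forall_notMem ?_
      rintro x ⟨i, j, hij, -⟩
      exact hm ⟨i, j, hij⟩
    rw [this, inv_zero]
    positivity

theorem exists_pos_forall_mul_lt (c : ℝ) {a : ℝ} (ha : 0 < a) :
    ∃ e : ℝ, 0 < e ∧ ∀ ε, 0 ≤ ε → ε ≤ e → ε * c < a := by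
  refine ⟨a / (|c| + 1), by positivity, fun ε h0 h1 => ?_⟩
  rw [le_div_iff₀ (by positivity)] at h1
  have h2 : ε * c ≤ ε * |c| := by gcongr; exact le_abs_self c
  rcases h0.eq_or_lt with h | h
  · simpa [← h] using ha
  · nlinarith

/-- The first-order error bound for a run on perturbed samples, for any exact run whose matrices
`S_ℓ` describe the action of the `T_ℓ` and are diagonalized simultaneously by `W`. The second
bound, with a constant `C` independent of the perturbed run, makes the error uniformly small. -/
theorem Run.exists_forall_frobNorm_le (hm : 0 < m) (hr : (matT n f).rank = m)
    (hμ : ∑ ℓ, ‖μ ℓ‖ ^ 2 = 1) (R : Run n m μ f) (hlam : Function.Injective R.lam)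
    (hTl : ∀ ℓ, matTl n f ℓ = firstCols R.hm R.U * R.S ℓ * ((firstCols R.hm R.U)ᴴ * matT n f))
    (hT : firstCols R.hm R.U * ((firstCols R.hm R.U)ᴴ * matT n f) = matT n f)
    {z : Fin d → Fin m → ℂ} (hz : ∀ ℓ j, ‖z ℓ j‖ ≤ 1)
    (hρ : ∀ ℓ, R.diagonalized ℓ = Matrix.diagonal (z ℓ)) :
    ∃ ε₀ C : ℝ, 0 < ε₀ ∧ ∀ ε, 0 ≤ ε → ε ≤ ε₀ → ∀ f' : (Fin d → ℤ) → ℂ,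
      (∀ k ∈ samplePoints d n, ‖f' k - f k‖ ≤ ε * ‖f k‖) →
      ∀ R' : Run n m μ f', 0 < deltaMin R R' → 0 < R'.svLast ∧ ∃ τ : Equiv.Perm (Fin m),
        (∀ i j, j ≠ i → ‖R'.lam (τ i) - R.lam i‖ < ‖R'.lam (τ i) - R.lam j‖) ∧
        (∀ ℓ, frobNorm ((R'.diagonalized ℓ).submatrix τ τ - Matrix.diagonal (z ℓ))
          ≤ ε * errorCoeff 7 R R' τ (Matrix.diagonal (z ℓ))) ∧
        ∀ ℓ, frobNorm ((R'.diagonalized ℓ).submatrix τ τ - Matrix.diagonal (z ℓ)) ≤ ε * C := by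
  set s := R.svLast with hs_def
  have hs : 0 < s := R.svLast_pos hm hr
  set N := frobNorm (matT n f) with hN_def
  have hsN : s ≤ N := R.svLast_le_frobNorm hm
  set M := ⨆ ℓ, frobNorm (matTl n f ℓ) with hM_def
  have hM : 0 ≤ M := Real.iSup_nonneg fun ℓ => frobNorm_nonneg _
  have hN : 0 ≤ N := frobNorm_nonneg _
  have hW : ∀ j, colNorm R.W j = 1 := fun j => colNorm_eq_one (R.W_norm j)
  obtain ⟨gap, hgap, hsep⟩ : ∃ gap : ℝ, 0 < gap ∧ ∀ i j, i ≠ j → gap ≤ ‖R.lam i - R.lam j‖ := by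
    obtain ⟨gap, h0, h⟩ := exists_pos_forall_le
      (fun p : {p : Fin m × Fin m // p.1 ≠ p.2} => ‖R.lam p.1.1 - R.lam p.1.2‖)
      (fun p => norm_pos_iff.2 (sub_ne_zero.2 fun h => p.2 (hlam h)))
    exact ⟨gap, h0, fun i j hij => h ⟨(i, j), hij⟩⟩
  obtain ⟨r, hr0, hmatch⟩ := exists_perm_of_intertwiner R.lam hgap hsep R.W_unit R.W_diag
  -- `b₀` bounds the first-order error of the intertwiner uniformly in the perturbed run.
  set b₀ := 3 * (2 / s) * M * (1 + N / s) with hb₀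
  set w := ‖R.W⁻¹‖ with hw_def
  set sm := Real.sqrt m
  set sd := Real.sqrt d
  obtain ⟨e₁, he₁, h₁⟩ := exists_pos_forall_mul_lt N (a := s / 4) (by positivity)
  obtain ⟨e₂, he₂, h₂⟩ := exists_pos_forall_mul_lt (w * (sd * b₀) * ‖R.W‖) hr0
  obtain ⟨e₃, he₃, h₃⟩ := exists_pos_forall_mul_lt (sm * w * (sd * b₀) * (gap / 2)⁻¹)
    (a := 1 / 4) (by norm_num)
  obtain ⟨e₄, he₄, h₄⟩ := exists_pos_forall_mul_lt
    (‖R.W‖ * (sm * w * (sd * b₀) * (gap / 2)⁻¹)) (a := 1 / 4) (by norm_num)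
  refine ⟨min e₁ (min e₂ (min e₃ e₄)),
    2 * (2 * (sm * w * (sd * b₀) * (gap / 2)⁻¹) + sm * w * b₀), by positivity,
    fun ε hε hε₀ f' hf' R' hδ => ?_⟩
  simp only [le_min_iff] at hε₀
  obtain ⟨hε₁, hε₂, hε₃, hε₄⟩ := hε₀
  replace h₁ := h₁ ε hε hε₁
  replace h₂ := h₂ ε hε hε₂
  replace h₃ := h₃ ε hε hε₃
  replace h₄ := h₄ ε hε hε₄
  set s' := R'.svLast with hs'_def
  have hs's : s / 2 ≤ s' := by
    have h := R.svLast_sub_le hm R'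
    have h' := frobNorm_matT_sub_le (n := n) hε hf'
    linarith
  have hs' : 0 < s' := lt_of_lt_of_le (by positivity) hs's
  refine ⟨hs', ?_⟩
  have hs'i : 1 / s' ≤ 2 / s := by
    rw [div_le_div_iff₀ hs' hs]
    linarith
  have hE : ε * N * (1 / s') ≤ 1 / 2 := by
    rw [mul_one_div, div_le_iff₀ hs']
    linarith
  obtain ⟨Q, hQ, hQi, hJ⟩ := Run.exists_intertwiner hε hs hs' hTl hT hf' hE
  set b := 3 * (1 / s') * M * (1 + N / s) with hb
  have hbb₀ : b ≤ b₀ := by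
    rw [hb, hb₀]
    gcongr
  have hJμ : frobNorm (Q * (∑ ℓ, μ ℓ • R'.S ℓ) - (∑ ℓ, μ ℓ • R.S ℓ) * Q) ≤ sd * (ε * b) := by
    have : Q * (∑ ℓ, μ ℓ • R'.S ℓ) - (∑ ℓ, μ ℓ • R.S ℓ) * Q
        = ∑ ℓ, μ ℓ • (Q * R'.S ℓ - R.S ℓ * Q) := by
      simp only [Matrix.mul_sum, Matrix.sum_mul, smul_sub, Finset.sum_sub_distrib,
        Matrix.mul_smul, Matrix.smul_mul]
    rw [this]
    exact frobNorm_weighted_sum_le hμ (by positivity) hJ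
  obtain ⟨τ, hτ⟩ := hmatch R'.W Q _ R'.lam R'.W_unit hQ hQi R'.W_diag (by
    refine lt_of_le_of_lt ?_ h₂
    calc _ ≤ w * (sd * (ε * b)) * ‖R.W‖ := by gcongr; exact hJμ
      _ ≤ w * (sd * (ε * b₀)) * ‖R.W‖ := by gcongr
      _ = _ := by ring)
  have hfar : ∀ i j, j ≠ i → gap / 2 ≤ ‖R.lam j - R'.lam (τ i)‖ := fun i j hij => by
    have h1 := hsep j i hij
    have h2 := hτ i
    have h3 := norm_sub_le_norm_sub_add_norm_sub (R.lam j) (R'.lam (τ i)) (R.lam i)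
    linarith
  set γ := gammaGap R R' τ with hγ_def
  have hγ : 0 ≤ γ := gammaGap_nonneg R R' τ
  have hγi : γ⁻¹ ≤ (gap / 2)⁻¹ := inv_gammaGap_le (by positivity) hfar
  have hsmall : sm * w * (sd * (ε * b)) / γ ≤ ε * (sm * w * (sd * b₀) * (gap / 2)⁻¹) := by
    rw [div_eq_mul_inv]
    calc _ ≤ sm * w * (sd * (ε * b₀)) * (gap / 2)⁻¹ := by gcongr
      _ = _ := by ring
  set W' := R'.W.submatrix id τ with hW'_def
  have hWu' : IsUnit W'.det := by
    have : W'.det = R'.W.det * Equiv.Perm.sign τ := by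
      rw [hW'_def, Matrix.det_permute', mul_comm]
    rw [this]
    exact R'.W_unit.mul (((Equiv.Perm.sign τ).isUnit.map (Int.castRingHom ℂ)))
  have hdiag' : W'⁻¹ * (∑ ℓ, μ ℓ • R'.S ℓ) * W' = Matrix.diagonal fun i => R'.lam (τ i) := by
    rw [← submatrix_conj]
    have h : R'.W⁻¹ * (∑ ℓ, μ ℓ • R'.S ℓ) * R'.W = Matrix.diagonal R'.lam := R'.W_diag
    rw [h, Matrix.submatrix_diagonal _ _ τ.injective]
    rfl
  have hmain : ∀ ℓ, frobNorm ((R'.diagonalized ℓ).submatrix τ τ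
      - Matrix.diagonal (z ℓ))
      ≤ 2 * (2 * ‖Matrix.diagonal (z ℓ)‖ *
        (sm * w * (sd * (ε * b)) / γ) + sm * w * (ε * b)) := fun ℓ => by
    have h : (R'.diagonalized ℓ).submatrix τ τ = W'⁻¹ * R'.S ℓ * W' :=
      submatrix_conj R'.W (R'.S ℓ) τ
    rw [h]
    refine frobNorm_conj_sub_diagonal_le hγ (fun i j hij => ⟨?_, ?_⟩) R.W_unit hWu' hW ?_ hQ
      hQi R.W_diag hdiag' (hρ ℓ) hJμ (hJ ℓ) ?_ ?_
    · exact lt_of_lt_of_le (by positivity) (le_gammaGap hfar hij)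
    · rw [norm_sub_rev]
      exact gammaGap_le R R' τ hij
    · intro j
      rw [hW'_def, colNorm_submatrix]
      exact colNorm_eq_one (R'.W_norm _)
    · exact hsmall.trans h₃.le
    · refine le_trans ?_ h₄.le
      calc _ ≤ ‖R.W‖ * (ε * (sm * w * (sd * b₀) * (gap / 2)⁻¹)) := by gcongr
        _ = _ := by ring
  have hWn : 1 ≤ ‖R.W‖ := by
    have h := colNorm_mul_le R.W (1 : Matrix (Fin m) (Fin m) ℂ) ⟨0, hm⟩
    have h1 : colNorm (1 : Matrix (Fin m) (Fin m) ℂ) ⟨0, hm⟩ = 1 := by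
      apply colNorm_eq_one
      rw [Finset.sum_eq_single ⟨0, hm⟩] <;> simp +contextual
    rw [Matrix.mul_one, hW, h1, mul_one] at h
    exact h
  have hbound : ∀ ℓ, frobNorm ((R'.diagonalized ℓ).submatrix τ τ
      - Matrix.diagonal (z ℓ))
      ≤ ε * errorCoeff 7 R R' τ
        (Matrix.diagonal (z ℓ)) := fun ℓ => by
    refine (hmain ℓ).trans ?_
    exact bound_le_coeff (by exact_mod_cast hm) hε (norm_nonneg _) hγ hδ
      (deltaMin_le_svLast hm R R') hs' (sigmaMin_pos hm R.W_unit)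
      (sigmaMin_le_one hm R.W_norm) hM hsN (norm_nonneg _)
      (le_mul_of_one_le_left (norm_nonneg _) hWn)
  refine ⟨τ, fun i j hij => ?_, hbound, fun ℓ => (hmain ℓ).trans ?_⟩
  · have h1 := hfar i j hij
    have h2 := hτ i
    rw [norm_sub_rev (R'.lam (τ i)) (R.lam j)]
    linarith
  · have hz1 : ‖Matrix.diagonal (z ℓ)‖ ≤ 1 := by
      rw [Matrix.l2_opNorm_diagonal, pi_norm_le_iff_of_nonneg zero_le_one]
      exact hz ℓ
    calc _ ≤ 2 * (2 * 1 * (ε * (sm * w * (sd * b₀) * (gap / 2)⁻¹)) + sm * w * (ε * b₀)) := by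
          gcongr
      _ = _ := by ring

end RunPerturbation

end Prony

/-! ### The theorem -/

theorem mainTheorem1 :
    ∃ g : ℝ, 0 < g ∧
      ∀ (d m n : ℕ) (_ : 0 < m)
        (t : Fin m → Fin d → ℝ) (_ : ∀ j i, t j i ∈ Set.Ico (0 : ℝ) 1)
        (_ : Function.Injective t)
        (c : Fin m → ℂ) (_ : ∀ j, c j ≠ 0)
        (_ : (Prony.matT n (Prony.expSum t c)).rank = m)
        (μ : Fin d → ℂ) (_ : ∑ ℓ, ‖μ ℓ‖ ^ 2 = 1)
        (R : Prony.Run n m μ (Prony.expSum t c)) (_ : Function.Injective R.lam),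
      ∃ ρ : Equiv.Perm (Fin m),
        (∀ ℓ, R.diagonalized ℓ = Matrix.diagonal fun j => Prony.node (t (ρ j)) ℓ) ∧
        ∃ K ε₀ : ℝ, 0 < ε₀ ∧
          ∀ (ε : ℝ) (_ : 0 ≤ ε) (_ : ε ≤ ε₀)
            (f' : (Fin d → ℤ) → ℂ)
            (_ : ∀ k ∈ Prony.samplePoints d n,
              ‖f' k - Prony.expSum t c k‖ ≤ ε * ‖Prony.expSum t c k‖)
            (R' : Prony.Run n m μ f') (_ : 0 < Prony.deltaMin R R'),
          0 < R'.svLast ∧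
          ∃ τ : Equiv.Perm (Fin m),
            -- the eigenvalue paired with `λ_i` is strictly closer to it than to any other `λ_j`
            (∀ i j, j ≠ i → ‖R'.lam (τ i) - R.lam i‖ < ‖R'.lam (τ i) - R.lam j‖) ∧
            (∀ ℓ,
              Prony.frobNorm ((R'.diagonalized ℓ).submatrix τ τ
                  - Matrix.diagonal fun j => Prony.node (t (ρ j)) ℓ)
                ≤ ε * Prony.errorCoeff g R R' τ
                    (Matrix.diagonal fun j => Prony.node (t (ρ j)) ℓ) + K * ε ^ 2) ∧
            (∀ j ℓ,
              ‖R'.recNode (τ j) ℓ - Prony.node (t (ρ j)) ℓ‖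
                ≤ ε * Prony.errorCoeff g R R' τ
                    (Matrix.diagonal fun i => Prony.node (t (ρ i)) ℓ) + K * ε ^ 2) ∧
            (0 < Prony.eta t → ∀ j ℓ,
              |R'.recParam (τ j) ℓ - t (ρ j) ℓ|
                ≤ ‖R'.recNode (τ j) ℓ - Prony.node (t (ρ j)) ℓ‖ / (Real.pi * Prony.eta t)
                  + K * ε ^ 2) := by
  refine ⟨7, by norm_num, fun d m n hm t ht _ c _ hr μ hμ R hlam => ?_⟩
  obtain ⟨ρ, hρ, hTl, hT⟩ := R.exists_perm_diagonalized_eq hm hr hlam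
  obtain ⟨e₁, C, he₁, h⟩ := Prony.Run.exists_forall_frobNorm_le hm hr hμ R hlam hTl hT
    (fun ℓ j => (Prony.norm_node (t (ρ j)) ℓ).le) hρ
  -- A margin that keeps all parameters, and their perturbations, away from the ends of `[0, 1]`.
  obtain ⟨a, ha, hta⟩ : ∃ a : ℝ, 0 < a ∧
      (0 < Prony.eta t → ∀ j ℓ, a ≤ t j ℓ ∧ a ≤ 1 - t j ℓ) := by
    by_cases h : 0 < Prony.eta t
    · obtain ⟨a, h0, h1⟩ := Prony.exists_pos_forall_le
        (fun p : Fin m × Fin d => min (t p.1 p.2) (1 - t p.1 p.2))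
        (fun p => lt_min (Prony.pos_of_eta_pos ht h _ _) (by linarith [(ht p.1 p.2).2]))
      exact ⟨a, h0, fun _ j ℓ => ⟨(h1 (j, ℓ)).trans (min_le_left _ _),
        (h1 (j, ℓ)).trans (min_le_right _ _)⟩⟩
    · exact ⟨1, one_pos, fun h' => absurd h' h⟩
  obtain ⟨e₂, he₂, hC⟩ := Prony.exists_pos_forall_mul_lt C (a := min a (1 / 2)) (by positivity)
  -- The first-order bound already has slack to absorb the terms of second order: `K = 0`.
  refine ⟨ρ, hρ, 0, min e₁ e₂, lt_min he₁ he₂, fun ε hε hε₀ f' hf' R' hδ => ?_⟩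
  obtain ⟨hs', τ, hτ, hbound, hsmall⟩ := h ε hε (hε₀.trans (min_le_left _ _)) f' hf' R' hδ
  have hentry : ∀ j ℓ, ‖R'.recNode (τ j) ℓ - Prony.node (t (ρ j)) ℓ‖
      ≤ Prony.frobNorm ((R'.diagonalized ℓ).submatrix τ τ
        - Matrix.diagonal fun j => Prony.node (t (ρ j)) ℓ) := fun j ℓ => by
    have h := Prony.norm_apply_le_frobNorm ((R'.diagonalized ℓ).submatrix τ τ
      - Matrix.diagonal fun j => Prony.node (t (ρ j)) ℓ) j j
    rwa [Matrix.sub_apply, Matrix.diagonal_apply_eq] at h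
  simp only [zero_mul, add_zero]
  refine ⟨hs', τ, hτ, hbound, fun j ℓ => (hentry j ℓ).trans (hbound ℓ), fun hη j ℓ => ?_⟩
  have hlt : ‖R'.recNode (τ j) ℓ - Prony.node (t (ρ j)) ℓ‖ < min a (1 / 2) :=
    ((hentry j ℓ).trans (hsmall ℓ)).trans_lt (hC ε hε (hε₀.trans (min_le_right _ _)))
  obtain ⟨hta0, hta1⟩ := hta hη (ρ j) ℓ
  refine (Prony.abs_fract_log_sub_le ha hta0 hta1 hlt).trans ?_
  have hη1 : Prony.eta t ≤ 1 :=
    (Prony.eta_le t j ℓ).trans (Prony.abs_re_mul_im_node_le_one _ _)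
  have hπ := Real.pi_pos
  have h : Real.pi * Prony.eta t ≤ Real.pi := mul_le_of_le_one_right hπ.le hη1
  change ‖R'.recNode (τ j) ℓ - Prony.node (t (ρ j)) ℓ‖ / Real.pi ≤ _
  gcongr
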